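/- Let $d \ge 2$, let $\mathbb B$ and $\mathbb S$ be the unit ball and unit sphere of $\mathbb R^d$ centered at the origin, and let $\Omega = \{ r\xi : \xi \in \mathbb S,\ 0 \le r < R(\xi)\}$ be a Lipschitz-starlike domain, where the radius function $R : \mathbb S \to (0,\infty)$ is Lipschitz continuous. Extend $R$ to $\mathbb R^d \setminus \{0\}$ by $R(r\xi)=R(\xi)$ for $r>0$, $\xi\in\mathbb S$, and let $\nabla R$ be the gradient of this extension (it exists almost everywhere on $\mathbb S$). Write $V$ for volume, $|\partial\Omega|$ for the surface area of the boundary (its $(d-1)$-dimensional Hausdorff measure), $dS$ for the surface measure on $\mathbb S$ and $|\mathbb S|$ for the total surface area of $\mathbb S$. Define \[ G_0 = \frac{\frac{1}{|\mathbb S|}\int_{\mathbb S} \big[ R(\xi)^{d-2} + |\nabla R(\xi)|^2 R(\xi)^{d-4} \big]\, dS(\xi)}{\Big(\frac{1}{|\mathbb S|}\int_{\mathbb S} R(\xi)^d \, dS(\xi)\Big)^{(d-2)/d}}, \qquad G_{\mathrm{Robin}} = \left( \frac{|\partial\Omega|/V(\Omega)^{(d-1)/d}}{|\partial\mathbb B|/V(\mathbb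 B)^{(d-1)/d}} \right)^{2}. \] Then \[ G_0 \ \ge\ G_{\mathrm{Robin}} \ \ge\ 1 . \] -/

import Mathlib

open MeasureTheory Metric

noncomputable section

namespace Starlike

/-- The unit sphere `𝕊^{d-1}` of `ℝ^d`, as a type, with the (chordal) distance of `ℝ^d`. -/
abbrev USphere (d : ℕ) : Type := sphere (0 : EuclideanSpace ℝ (Fin d)) 1

/-- Surface measure `dS` on the unit sphere. -/
abbrev sphereMeasure (d : ℕ) : Measure (USphere d) :=
  (volume : Measure (EuclideanSpace ℝ (Fin d))).toSphere

/-- `Ω` is the Lipschitz-starlike domain with radius function `R`: the function `R` is positive and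
Lipschitz continuous on the unit sphere, and `Ω = {rξ : ξ ∈ 𝕊, 0 ≤ r < R(ξ)}`. -/
structure IsLipschitzStarlike {d : ℕ} (Ω : Set (EuclideanSpace ℝ (Fin d)))
    (R : USphere d → ℝ) : Prop where
  pos : ∀ ξ, 0 < R ξ
  lipschitz : ∃ K : NNReal, LipschitzWith K R
  eq_set : Ω = {x | ∃ (ξ : USphere d) (r : ℝ), 0 ≤ r ∧ r < R ξ ∧
    x = r • (ξ : EuclideanSpace ℝ (Fin d))}

/-- The extension of `R` to the nonzero vectors by homogeneity, `R(rξ) = R(ξ)` for `r > 0`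
(with the value `0` at the origin, where the extension is not defined). -/
def homExt {d : ℕ} (R : USphere d → ℝ) (x : EuclideanSpace ℝ (Fin d)) : ℝ :=
  if hx : x ≠ 0 then
    R ⟨‖x‖⁻¹ • x, by
      rw [mem_sphere_zero_iff_norm, norm_smul, norm_inv, norm_norm,
        inv_mul_cancel₀ (norm_ne_zero_iff.mpr hx)]⟩
  else 0

/-- The geometric factor
`G₀ = (avg_𝕊 [R^{d-2} + |∇R|² R^{d-4}]) / (avg_𝕊 R^d)^{(d-2)/d}`,
where `∇R` is the gradient in `ℝ^d` of the homogeneous extension of `R`. -/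
def G0 {d : ℕ} (R : USphere d → ℝ) : ℝ :=
  (⨍ ξ, (R ξ ^ ((d : ℤ) - 2) +
      ‖gradient (homExt R) (ξ : EuclideanSpace ℝ (Fin d))‖ ^ 2 * R ξ ^ ((d : ℤ) - 4))
        ∂(sphereMeasure d)) /
    (⨍ ξ, R ξ ^ d ∂(sphereMeasure d)) ^ (((d : ℝ) - 2) / (d : ℝ))

/-- Surface area of the boundary: the `(d-1)`-dimensional Hausdorff measure, in the Euclidean
normalization, of the topological boundary. -/
def boundaryArea {d : ℕ} (Ω : Set (EuclideanSpace ℝ (Fin d))) : ℝ :=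
  (μHE[d - 1] : Measure (EuclideanSpace ℝ (Fin d))).real (frontier Ω)

/-- The scale invariant ratio `|∂Ω| / V(Ω)^{(d-1)/d}`. -/
def isoRatio {d : ℕ} (Ω : Set (EuclideanSpace ℝ (Fin d))) : ℝ :=
  boundaryArea Ω / (volume.real Ω) ^ (((d : ℝ) - 1) / (d : ℝ))

/-- The geometric factor `G_Robin`: the square of the ratio `|∂Ω| / V(Ω)^{(d-1)/d}`, normalized by
its value for the unit ball. -/
def GRobin {d : ℕ} (Ω : Set (EuclideanSpace ℝ (Fin d))) : ℝ :=
  (isoRatio Ω / isoRatio (ball (0 : EuclideanSpace ℝ (Fin d)) 1)) ^ 2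

end Starlike

end

section

open Set Filter Topology Measure Module
open scoped ENNReal NNReal Pointwise RealInnerProductSpace

namespace Starlike

section

/-! ### Hausdorff measure and Lipschitz maps -/

section Hausdorff

variable {X Y : Type*} [MetricSpace X] [MeasurableSpace X] [BorelSpace X]
  [MetricSpace Y] [MeasurableSpace Y] [BorelSpace Y]

/-! Everything is read off the gauge `g x = ‖x‖ / R (x / ‖x‖)`, which is Lipschitz and positively
homogeneous of degree 1, with Ω = {g < 1} and ∂Ω = {g = 1}. Write V(Ω) = α^d, V(𝔹) = β^d and I = ∫_Ω
|∇g|. Three facts about I give the theorem.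

Area (`area_level_set`): |∂Ω| = d·I. If g is linear, this is the volume formula for a cone over a
flat base. In general g is almost linear on the cones over the pieces of a countable partition of
the differentiability points, and a shear close to the identity flattens each piece; the error
factors tend to 1. The remaining points of ∂Ω span a null cone by Rademacher's theorem, so they have
area zero. Hence G_Robin = (I / (α^(d-1) β))².

Energy (`sq_gradient_integral_le`): on the sphere ∇g = ξ/R − ∇R/R² with ∇R ⊥ ξ, so R^d |∇g|² is the
integrand of G₀ wherever R is differentiable. As |∇g|² is homogeneous of degree 0, polar coordinates
bound d ∫_Ω |∇g|² by the integral in the numerator of G₀. Cauchy–Schwarz, I² ≤ V(Ω) ∫_Ω |∇g|², is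
then G_Robin ≤ G₀.

Isoperimetry (`isoperimetric`): I ≥ α^(d-1) β, which is G_Robin ≥ 1. Brunn–Minkowski, obtained from
Prékopa–Leindler, bounds below the volume of the ε-shell around each {g < t}; integrating over 0 < t
< 1, exchanging the integrals and letting ε → 0 turns the shells into ∫_Ω |∇g|. -/

theorem euclideanHausdorffMeasure_image_le {f : X → Y} {s : Set X} {K : ℝ≥0}
    (h : LipschitzOnWith K f s) (n : ℕ) :
    μHE[n] (f '' s) ≤ (K : ℝ≥0∞) ^ n * μHE[n] s := by
  have := h.hausdorffMeasure_image_le (d := n) (by positivity)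
  rw [ENNReal.rpow_natCast] at this
  simp only [euclideanHausdorffMeasure_def, Measure.smul_apply, ENNReal.smul_def, smul_eq_mul]
  rw [mul_left_comm]
  gcongr

theorem euclideanHausdorffMeasure_le_image {f : X → Y} {s : Set X} {K : ℝ≥0}
    (h : ∀ x ∈ s, ∀ y ∈ s, dist x y ≤ K * dist (f x) (f y)) (n : ℕ) :
    μHE[n] s ≤ (K : ℝ≥0∞) ^ n * μHE[n] (f '' s) := by
  rcases s.eq_empty_or_nonempty with rfl | ⟨x₀, hx₀⟩
  · simp
  have : Nonempty X := ⟨x₀⟩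
  have hinj : InjOn f s := fun x hx y hy hxy ↦ by
    have := h x hx y hy
    rw [hxy, dist_self, mul_zero] at this
    exact dist_le_zero.1 this
  have hl : LipschitzOnWith K (Function.invFunOn f s) (f '' s) := by
    refine LipschitzOnWith.of_dist_le_mul ?_
    rintro _ ⟨x, hx, rfl⟩ _ ⟨y, hy, rfl⟩
    rw [hinj.leftInvOn_invFunOn hx, hinj.leftInvOn_invFunOn hy]
    exact h x hx y hy
  have := euclideanHausdorffMeasure_image_le hl n
  rwa [hinj.leftInvOn_invFunOn.image_image] at this

end Hausdorff

variable {V : Type*} [NormedAddCommGroup V] [InnerProductSpace ℝ V] [FiniteDimensional ℝ V]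
  [MeasurableSpace V] [BorelSpace V]

/-! ### The cone over a flat set -/

omit [FiniteDimensional ℝ V] [MeasurableSpace V] [BorelSpace V] in
theorem mem_Ioo_smul_iff_of_flat {v : V} {h : ℝ} (hh : 0 < h) {W : Set V}
    (hW : ∀ y ∈ W, ⟪v, y⟫ = h) (z : V) :
    z ∈ Ioo (0 : ℝ) 1 • W ↔ ⟪v, z⟫ ∈ Ioo 0 h ∧ (h / ⟪v, z⟫) • z ∈ W := by
  constructor
  · rintro ⟨t, ⟨ht0, ht1⟩, y, hy, rfl⟩
    have hy' := hW y hy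
    simp only [inner_smul_right, hy', smul_smul]
    refine ⟨⟨by positivity, by nlinarith⟩, ?_⟩
    convert hy
    rw [show h / (t * h) * t = 1 by field_simp, one_smul]
  · rintro ⟨⟨h0, h1⟩, hz⟩
    refine ⟨⟪v, z⟫ / h, ⟨by positivity, (div_lt_one hh).2 h1⟩, _, hz, ?_⟩
    simp only [smul_smul]
    rw [show ⟪v, z⟫ / h * (h / ⟪v, z⟫) = 1 by field_simp, one_smul]

/-- The volume of the cone with apex `0` over a subset of a hyperplane at distance `h`. -/
theorem volume_cone_flat {v : V} (hv : ‖v‖ = 1) {h : ℝ} (hh : 0 < h) {W : Set V}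
    (hWm : MeasurableSet W) (hW : ∀ y ∈ W, ⟪v, y⟫ = h) :
    volume (Ioo (0 : ℝ) 1 • W) =
      ENNReal.ofReal (h / finrank ℝ V) * μHE[finrank ℝ V - 1] W := by
  have hv0 : v ≠ 0 := by rintro rfl; simp at hv
  have : Nontrivial V := ⟨v, 0, hv0⟩
  have hd : 0 < finrank ℝ V := finrank_pos
  have hset : Ioo (0 : ℝ) 1 • W = {z | ⟪v, z⟫ ∈ Ioo 0 h} ∩ {z | (h / ⟪v, z⟫) • z ∈ W} := by
    ext z; exact mem_Ioo_smul_iff_of_flat hh hW z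
  have hmeas : MeasurableSet (Ioo (0 : ℝ) 1 • W) := by
    rw [hset]
    refine MeasurableSet.inter ?_ ?_
    · exact (by fun_prop : Measurable fun z : V ↦ ⟪v, z⟫) measurableSet_Ioo
    · exact (by fun_prop : Measurable fun z : V ↦ (h / ⟪v, z⟫) • z) hWm
  -- Fubini over the hyperplanes orthogonal to `v`: the slice at height s in (0, h) is `(s / h) •
  -- W`, and (s/h)^(d-1) integrates to h/d.
  rw [← InnerProductSpace.euclideanHausdorffMeasure_eq_volume,
    EuclideanGeometry.euclideanHausdorffMeasure_eq_lintegral (0 : V) hv0 hmeas]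
  have hmem : ∀ (s : ℝ) (z : V), z ∈ AffineSubspace.mk' (s • v +ᵥ (0 : V)) (ℝ ∙ v)ᗮ ↔
      ⟪v, z⟫ = s := by
    intro s z
    rw [AffineSubspace.mem_mk', Submodule.mem_orthogonal_singleton_iff_inner_right]
    simp [inner_sub_right, inner_smul_right, hv, sub_eq_zero]
  have hslice : ∀ s : ℝ, μHE[finrank ℝ V - 1]
      (Ioo (0 : ℝ) 1 • W ∩ AffineSubspace.mk' (s • v +ᵥ (0 : V)) (ℝ ∙ v)ᗮ) =
      (Ioo 0 h).indicator (fun s ↦ ENNReal.ofReal ((s / h) ^ (finrank ℝ V - 1)) *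
        μHE[finrank ℝ V - 1] W) s := by
    intro s
    by_cases hs : s ∈ Ioo 0 h
    · have hs0 : 0 < s := hs.1
      have : (Ioo (0 : ℝ) 1 • W ∩ AffineSubspace.mk' (s • v +ᵥ (0 : V)) (ℝ ∙ v)ᗮ : Set V) =
          (s / h) • W := by
        ext z
        rw [mem_inter_iff, mem_Ioo_smul_iff_of_flat hh hW, SetLike.mem_coe, hmem,
          mem_smul_set_iff_inv_smul_mem₀ (by positivity), inv_div]
        constructor
        · rintro ⟨⟨-, h2⟩, rfl⟩; exact h2
        · intro h2
          have hz := hW _ h2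
          rw [inner_smul_right] at hz
          have : ⟪v, z⟫ = s := by field_simp at hz; linarith
          rw [this]; exact ⟨⟨hs, h2⟩, rfl⟩
      rw [this, euclideanHausdorffMeasure_smul₀ _ (by positivity), indicator_of_mem hs,
        ENNReal.smul_def, smul_eq_mul]
      congr 1
      rw [ENNReal.ofReal_pow (by positivity), ENNReal.coe_pow, ← enorm_eq_nnnorm,
        Real.enorm_of_nonneg (by positivity)]
    · rw [indicator_of_notMem hs]
      refine (congrArg _ ?_).trans measure_empty
      ext z
      simp only [mem_inter_iff, mem_empty_iff_false, iff_false, not_and]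
      rw [mem_Ioo_smul_iff_of_flat hh hW, SetLike.mem_coe, hmem]
      rintro ⟨h1, -⟩ rfl
      exact hs h1
  simp_rw [hslice]
  rw [lintegral_indicator measurableSet_Ioo, lintegral_mul_const _ (by fun_prop),
    ← ofReal_norm, hv, ENNReal.ofReal_one, one_mul]
  congr 1
  rw [← ofReal_integral_eq_lintegral_ofReal]
  · rw [← integral_Ioc_eq_integral_Ioo, ← intervalIntegral.integral_of_le hh.le]
    simp only [div_pow, intervalIntegral.integral_div, integral_pow]
    rw [Nat.sub_add_cancel hd, zero_pow hd.ne', Nat.cast_pred hd, sub_zero, sub_add_cancel]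
    congr 1
    have : h ^ finrank ℝ V = h * h ^ (finrank ℝ V - 1) := by
      rw [← pow_succ', Nat.sub_add_cancel hd]
    rw [this]; field_simp
  · exact (Continuous.integrableOn_Icc (by fun_prop)).mono_set Ioo_subset_Icc_self
  · filter_upwards [ae_restrict_mem measurableSet_Ioo] with s hs
    have := hs.1
    positivity

end

section

variable {V : Type*} [NormedAddCommGroup V] [InnerProductSpace ℝ V]

/-! ### Gauges -/

/-- A positively homogeneous Lipschitz function on `V` that dominates a multiple of the norm. -/
structure IsGauge (g : V → ℝ) (c : ℝ) (L : ℝ≥0) : Prop where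
  lipschitz : LipschitzWith L g
  map_smul : ∀ t : ℝ, 0 < t → ∀ x, g (t • x) = t * g x
  pos : 0 < c
  le : ∀ x, c * ‖x‖ ≤ g x

/-- The open cone with apex `0` over a subset `E` of the level set `g = 1`. -/
def coneOver (g : V → ℝ) (E : Set V) : Set V :=
  {z | 0 < g z ∧ g z < 1 ∧ (g z)⁻¹ • z ∈ E}

namespace IsGauge

variable {g : V → ℝ} {c : ℝ} {L : ℝ≥0} (hg : IsGauge g c L)
include hg

theorem map_zero : g 0 = 0 := by
  have := hg.map_smul 2 two_pos 0
  rw [smul_zero] at this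
  linarith

theorem continuous : Continuous g := hg.lipschitz.continuous

theorem pos_of_ne {x : V} (hx : x ≠ 0) : 0 < g x :=
  (mul_pos hg.pos (norm_pos_iff.2 hx)).trans_le (hg.le x)

theorem abs_sub_le (x y : V) : |g x - g y| ≤ L * ‖x - y‖ := by
  simpa [dist_eq_norm] using hg.lipschitz.dist_le_mul x y

theorem norm_le_of_eq_one {x : V} (hx : g x = 1) : ‖x‖ ≤ c⁻¹ := by
  have := hg.le x
  rw [hx] at this
  rw [← one_div, le_div_iff₀ hg.pos]; linarith

theorem coneOver_eq_smul {E : Set V} (hE : ∀ x ∈ E, g x = 1) :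
    coneOver g E = Ioo (0 : ℝ) 1 • E := by
  ext z
  constructor
  · rintro ⟨h0, h1, h2⟩
    exact ⟨g z, ⟨h0, h1⟩, _, h2, by simp [smul_smul, h0.ne']⟩
  · rintro ⟨t, ⟨h0, h1⟩, x, hx, rfl⟩
    simp only [coneOver, mem_ofPred_eq, hg.map_smul t h0, hE x hx, mul_one, smul_smul,
      inv_mul_cancel₀ h0.ne', one_smul]
    exact ⟨h0, h1, hx⟩

/-- Differentiate g(ty) = t g(y) in y. At points of non-differentiability both sides are the default
value 0. -/
theorem fderiv_smul {t : ℝ} (ht : 0 < t) (x : V) : fderiv ℝ g (t • x) = fderiv ℝ g x := by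
  have h1 : (fun y ↦ g (t • y)) = fun y ↦ t • g y := by
    ext y; rw [hg.map_smul t ht, smul_eq_mul]
  have h2 : fderiv ℝ (fun y ↦ g (t • y)) x = t • fderiv ℝ g (t • x) := fderiv_comp_smul ..
  have h3 : fderiv ℝ (fun y ↦ t • g y) x = t • fderiv ℝ g x :=
    congrFun (fderiv_const_smul_field (f := g) t) x
  rw [h1, h3] at h2
  exact (smul_right_injective _ ht.ne' h2).symm

theorem differentiableAt_smul {t : ℝ} (ht : 0 < t) {x : V} (hx : DifferentiableAt ℝ g x) :
    DifferentiableAt ℝ g (t • x) := by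
  have h1 : g = fun y ↦ t * g (t⁻¹ • y) := by
    ext y
    rw [hg.map_smul _ (inv_pos.2 ht), mul_inv_cancel_left₀ ht.ne']
  rw [h1]
  refine DifferentiableAt.const_mul (DifferentiableAt.comp (f := fun y : V ↦ t⁻¹ • y) _ ?_ ?_) _
  · simpa [smul_smul, ht.ne'] using hx
  · fun_prop

/-- Euler's identity for degree 1: differentiate g(tx) = t g(x) at t = 1. -/
theorem fderiv_apply_self {x : V} (hx : DifferentiableAt ℝ g x) : fderiv ℝ g x x = g x := by
  have h1 : HasDerivAt (fun t : ℝ ↦ g (t • x)) (fderiv ℝ g x x) 1 := by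
    have h2 : HasDerivAt (fun t : ℝ ↦ t • x) x 1 := by
      simpa using (hasDerivAt_id (1 : ℝ)).smul_const x
    have h3 : HasFDerivAt g (fderiv ℝ g x) ((1 : ℝ) • x) := by simpa using hx.hasFDerivAt
    exact h3.comp_hasDerivAt _ h2
  have h2 : HasDerivAt (fun t : ℝ ↦ g (t • x)) (g x) 1 := by
    have : HasDerivAt (fun t : ℝ ↦ t * g x) (g x) 1 := by
      simpa using (hasDerivAt_id (1 : ℝ)).mul_const (g x)
    refine this.congr_of_eventuallyEq ?_
    filter_upwards [lt_mem_nhds (zero_lt_one' ℝ)] with t ht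
    exact hg.map_smul t ht x
  exact h1.unique h2

/-- A linear approximation on a subset of the level set extends to the cone over it. -/
theorem approx_cone {E : Set V} (hE : ∀ x ∈ E, g x = 1) {A : V →L[ℝ] ℝ} {δ : ℝ≥0} {δ' : ℝ}
    (hA : ApproximatesLinearOn g A E δ) (hA' : ∀ x ∈ E, |A x - 1| ≤ δ')
    {t t' : ℝ} (ht : 0 < t) (ht' : 0 < t') {x x' : V} (hx : x ∈ E) (hx' : x' ∈ E) :
    |g (t • x) - g (t' • x') - A (t • x - t' • x')| ≤
      (δ' * L + δ * (1 + L / c)) * ‖t • x - t' • x'‖ := by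
  have hc := hg.pos
  have hgt : g (t • x) = t := by rw [hg.map_smul t ht, hE x hx, mul_one]
  have hgt' : g (t' • x') = t' := by rw [hg.map_smul t' ht', hE x' hx', mul_one]
  have h1 : |t - t'| ≤ L * ‖t • x - t' • x'‖ := by
    have := hg.abs_sub_le (t • x) (t' • x')
    rwa [hgt, hgt'] at this
  have h2 : ‖t' • (x - x')‖ ≤ (1 + L / c) * ‖t • x - t' • x'‖ := by
    have e : t' • (x - x') = (t • x - t' • x') - (t - t') • x := by
      rw [smul_sub, sub_smul]; abel
    have := norm_sub_le (t • x - t' • x') ((t - t') • x)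
    rw [← e, norm_smul (t - t'), Real.norm_eq_abs] at this
    have h3 : |t - t'| * ‖x‖ ≤ (L * ‖t • x - t' • x'‖) * c⁻¹ := by
      gcongr
      exact hg.norm_le_of_eq_one (hE x hx)
    calc _ ≤ _ := this
      _ ≤ ‖t • x - t' • x'‖ + (L * ‖t • x - t' • x'‖) * c⁻¹ := by gcongr
      _ = _ := by rw [div_eq_mul_inv]; ring
  have h3 : |A (x - x')| ≤ δ * ‖x - x'‖ := by
    have := hA x hx x' hx'
    rw [hE x hx, hE x' hx', sub_self, zero_sub, norm_neg] at this
    exact this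
  have h4 : |t' * A (x - x')| ≤ δ * ‖t' • (x - x')‖ := by
    rw [abs_mul, norm_smul, Real.norm_eq_abs]
    calc |t'| * |A (x - x')| ≤ |t'| * (δ * ‖x - x'‖) := by gcongr
      _ = _ := by ring
  -- The radial part of the error is small because `A x` is close to 1 = `g x`, the tangential part
  -- because `g` is constant on `E`. The factor t − t' is controlled since `g` recovers t from `t •
  -- x`.
  have e : g (t • x) - g (t' • x') - A (t • x - t' • x') =
      (t - t') * (-(A x - 1)) + -(t' * A (x - x')) := by
    rw [hgt, hgt', map_sub, map_sub, _root_.map_smul, _root_.map_smul, smul_eq_mul,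
      smul_eq_mul]
    ring
  have hδ' : 0 ≤ δ' := (abs_nonneg _).trans (hA' x hx)
  rw [e]
  calc _ ≤ |(t - t') * (-(A x - 1))| + |-(t' * A (x - x'))| := abs_add_le _ _
    _ ≤ (L * ‖t • x - t' • x'‖) * δ' + δ * ((1 + L / c) * ‖t • x - t' • x'‖) := by
        rw [abs_mul, abs_neg, abs_neg]
        gcongr
        · exact hA' x hx
        · exact h4.trans (by gcongr)
    _ = _ := by ring

variable [FiniteDimensional ℝ V] [MeasurableSpace V] [BorelSpace V]

omit [FiniteDimensional ℝ V] in
theorem measurableSet_coneOver {E : Set V} (hE : MeasurableSet E) :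
    MeasurableSet (coneOver g E) := by
  have := hg.continuous.measurable
  exact (measurableSet_lt measurable_const this).inter
    ((measurableSet_lt this measurable_const).inter ((this.inv.smul measurable_id) hE))

/-- If `g` is almost linear on the cone over `E`, then the volume of the cone and the area of `E`
are almost related as for a flat set. -/
theorem cone_comparison {E : Set V} (hEm : MeasurableSet E) (hE : ∀ x ∈ E, g x = 1) {v : V}
    (hv : ‖v‖ = 1) {h : ℝ} (hh : 0 < h) {η : ℝ} (hη0 : 0 ≤ η) (hη1 : η < 1)
    (happ : ∀ t t' : ℝ, 0 < t → 0 < t' → ∀ x ∈ E, ∀ x' ∈ E,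
      |h * (g (t • x) - g (t' • x')) - ⟪v, t • x - t' • x'⟫| ≤ η * ‖t • x - t' • x'‖) :
    ENNReal.ofReal (h / finrank ℝ V) * μHE[finrank ℝ V - 1] E ≤
        ENNReal.ofReal (((1 + η) / (1 - η)) ^ finrank ℝ V) * volume (coneOver g E) ∧
      volume (coneOver g E) ≤ ENNReal.ofReal (((1 + η) / (1 - η)) ^ finrank ℝ V) *
        (ENNReal.ofReal (h / finrank ℝ V) * μHE[finrank ℝ V - 1] E) := by
  set d := finrank ℝ V
  -- The shear that replaces the `v`-coordinate by `h * g z`. It is homogeneous of degree 1 and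
  -- sends `E` into the hyperplane at height `h`, so it carries the cone over `E` to a flat cone; by
  -- `happ` it differs from the identity by an `η`-Lipschitz map on the infinite cone `Z`.
  set T : V → V := fun z ↦ z + (h * g z - ⟪v, z⟫) • v with hT
  set Z : Set V := Ioi (0 : ℝ) • E
  have hsub1 : coneOver g E ⊆ Z := by
    rw [hg.coneOver_eq_smul hE]
    exact smul_subset_smul_right Ioo_subset_Ioi_self
  have hsub2 : E ⊆ Z := fun x hx ↦ ⟨1, mem_Ioi.2 one_pos, x, hx, one_smul _ _⟩
  have hTZ : ∀ z ∈ Z, ∀ z' ∈ Z, ‖(T z - T z') - (z - z')‖ ≤ η * ‖z - z'‖ := by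
    rintro _ ⟨t, ht, x, hx, rfl⟩ _ ⟨t', ht', x', hx', rfl⟩
    have e : (T (t • x) - T (t' • x')) - (t • x - t' • x') =
      (h * (g (t • x) - g (t' • x')) - ⟪v, t • x - t' • x'⟫) • v := by
      simp only [hT, inner_sub_right]
      module
    show ‖T (t • x) - T (t' • x') - (t • x - t' • x')‖ ≤ _
    rw [e, norm_smul, hv, mul_one]
    exact happ t t' ht ht' x hx x' hx'
  have h1η : 0 < 1 - η := by linarith
  have hlip : LipschitzOnWith (1 + η).toNNReal T Z := by
    refine LipschitzOnWith.of_dist_le_mul fun z hz z' hz' ↦ ?_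
    rw [dist_eq_norm, dist_eq_norm, Real.coe_toNNReal _ (by positivity)]
    have := norm_add_le ((T z - T z') - (z - z')) (z - z')
    rw [sub_add_cancel] at this
    linarith [hTZ z hz z' hz']
  have hanti : ∀ z ∈ Z, ∀ z' ∈ Z, dist z z' ≤ ((1 - η)⁻¹.toNNReal : ℝ) * dist (T z) (T z') := by
    intro z hz z' hz'
    rw [dist_eq_norm, dist_eq_norm, Real.coe_toNNReal _ (by positivity), inv_mul_eq_div,
      le_div_iff₀ h1η]
    have := norm_sub_le (T z - T z') ((T z - T z') - (z - z'))
    rw [sub_sub_cancel] at this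
    linarith [hTZ z hz z' hz']
  have hinj : InjOn T Z := fun x hx y hy hxy ↦ by
    have := hanti x hx y hy
    rw [hxy, dist_self, mul_zero] at this
    exact dist_le_zero.1 this
  have hTcont : Continuous T := by
    have := hg.continuous
    fun_prop
  have hTE : MeasurableSet (T '' E) :=
    hEm.image_of_continuousOn_injOn hTcont.continuousOn (hinj.mono hsub2)
  have hTinner : ∀ z, ⟪v, T z⟫ = h * g z := by
    intro z
    simp [hT, inner_add_right, inner_smul_right, hv]
  have hTsmul : ∀ t : ℝ, 0 < t → ∀ x, T (t • x) = t • T x := by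
    intro t ht x
    simp only [hT, hg.map_smul t ht, inner_smul_right]
    module
  have hcone : T '' coneOver g E = Ioo (0 : ℝ) 1 • (T '' E) := by
    rw [hg.coneOver_eq_smul hE]
    ext z
    constructor
    · rintro ⟨_, ⟨t, ht, x, hx, rfl⟩, rfl⟩
      exact ⟨t, ht, T x, ⟨x, hx, rfl⟩, (hTsmul t ht.1 x).symm⟩
    · rintro ⟨t, ht, _, ⟨x, hx, rfl⟩, rfl⟩
      exact ⟨t • x, ⟨t, ht, x, hx, rfl⟩, hTsmul t ht.1 x⟩
  have hflat : volume (T '' coneOver g E) = ENNReal.ofReal (h / d) * μHE[d - 1] (T '' E) := by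
    rw [hcone]
    refine volume_cone_flat hv hh hTE ?_
    rintro _ ⟨x, hx, rfl⟩
    rw [hTinner, hE x hx, mul_one]
  have a1 := euclideanHausdorffMeasure_image_le (hlip.mono hsub1) d
  have a2 := euclideanHausdorffMeasure_image_le (hlip.mono hsub2) (d - 1)
  have b1 := euclideanHausdorffMeasure_le_image
    (fun z hz z' hz' ↦ hanti z (hsub1 hz) z' (hsub1 hz')) d
  have b2 := euclideanHausdorffMeasure_le_image
    (fun z hz z' hz' ↦ hanti z (hsub2 hz) z' (hsub2 hz')) (d - 1)
  rw [InnerProductSpace.euclideanHausdorffMeasure_eq_volume] at a1 b1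
  set p : ℝ≥0∞ := ((1 + η).toNNReal : ℝ≥0∞)
  set q : ℝ≥0∞ := ((1 - η)⁻¹.toNNReal : ℝ≥0∞)
  -- Since both constants are at least 1, the exponents d − 1 coming from areas can be raised to d,
  -- giving one common factor.
  have hp : 1 ≤ p := by
    show 1 ≤ ENNReal.ofReal (1 + η)
    rw [ENNReal.one_le_ofReal]; linarith
  have hq : 1 ≤ q := by
    show 1 ≤ ENNReal.ofReal (1 - η)⁻¹
    rw [ENNReal.one_le_ofReal]
    exact (one_le_inv₀ h1η).2 (by linarith)
  have hQ : ENNReal.ofReal (((1 + η) / (1 - η)) ^ d) = p ^ d * q ^ d := by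
    rw [← mul_pow, ENNReal.ofReal_pow (by positivity), div_eq_mul_inv,
      ENNReal.ofReal_mul (by positivity)]
    rfl
  rw [hQ]
  constructor
  · calc _ ≤ ENNReal.ofReal (h / d) * (q ^ (d - 1) * μHE[d - 1] (T '' E)) := by gcongr
      _ = q ^ (d - 1) * volume (T '' coneOver g E) := by rw [hflat]; ring
      _ ≤ q ^ d * (p ^ d * volume (coneOver g E)) := by
        gcongr
        omega
      _ = _ := by ring
  · calc _ ≤ q ^ d * (ENNReal.ofReal (h / d) * μHE[d - 1] (T '' E)) := by rwa [← hflat]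
      _ ≤ q ^ d * (ENNReal.ofReal (h / d) * (p ^ d * μHE[d - 1] E)) := by
        gcongr
        refine a2.trans ?_
        gcongr
        omega
      _ = _ := by ring

end IsGauge

end

/-! ### The area of the differentiable part of a level set, by localization -/

section

/-- An inequality between measures may be checked locally. -/
theorem measure_le_of_countable_cover {α ι : Type*} [Countable ι] [MeasurableSpace α]
    {μ ν : Measure α} {U : ι → Set α} (hU : ∀ i, MeasurableSet (U i)) {S : Set α}
    (hS : S ⊆ ⋃ i, U i)
    (h : ∀ i, ∀ E ⊆ U i, MeasurableSet E → μ E ≤ ν E) {E : Set α} (hE : MeasurableSet E)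
    (hES : E ⊆ S) : μ E ≤ ν E := by
  rcases isEmpty_or_nonempty ι with hι | hι
  · have : E = ∅ := by simpa using hES.trans hS
    simp [this]
  obtain ⟨f, hf⟩ := exists_surjective_nat ι
  set D := disjointed fun n ↦ U (f n)
  have hDm : ∀ n, MeasurableSet (D n) := MeasurableSet.disjointed fun n ↦ hU (f n)
  have hEu : E = ⋃ n, E ∩ D n := by
    rw [← inter_iUnion, iUnion_disjointed, hf.iUnion_comp U, inter_eq_left.2 (hES.trans hS)]
  have hdisj : Pairwise (Function.onFun Disjoint fun n ↦ E ∩ D n) := fun i j hij ↦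
    (disjoint_disjointed _ hij).mono inter_subset_right inter_subset_right
  rw [hEu, measure_iUnion hdisj fun n ↦ hE.inter (hDm n),
    measure_iUnion hdisj fun n ↦ hE.inter (hDm n)]
  exact ENNReal.tsum_le_tsum fun n ↦ h (f n) _
    (inter_subset_right.trans (disjointed_subset _ _)) (hE.inter (hDm n))

variable {V : Type*} [NormedAddCommGroup V] [InnerProductSpace ℝ V] [FiniteDimensional ℝ V]
  [MeasurableSpace V] [BorelSpace V]

/-- `d` times the integral of `|∇g|` over cones, as a measure on the level set `g = 1`. -/
noncomputable def coneMeasure (g : V → ℝ) : Measure V :=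
  (finrank ℝ V : ℝ≥0∞) • ((volume.withDensity fun z ↦ ‖fderiv ℝ g z‖ₑ).restrict
    {z | 0 < g z ∧ g z < 1}).map fun z ↦ (g z)⁻¹ • z

namespace IsGauge

variable {g : V → ℝ} {c : ℝ} {L : ℝ≥0} (hg : IsGauge g c L)
include hg

theorem coneMeasure_apply {E : Set V} (hE : MeasurableSet E) :
    coneMeasure g E = finrank ℝ V * ∫⁻ z in coneOver g E, ‖fderiv ℝ g z‖ₑ := by
  have hm := hg.continuous.measurable
  have hcone : (fun z ↦ (g z)⁻¹ • z) ⁻¹' E ∩ {z | 0 < g z ∧ g z < 1} = coneOver g E := by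
    ext z
    simp only [coneOver, mem_inter_iff, mem_preimage, mem_ofPred_eq]
    tauto
  rw [coneMeasure, Measure.smul_apply, map_apply (by fun_prop) hE, restrict_apply
    ((by fun_prop : Measurable fun z ↦ (g z)⁻¹ • z) hE), hcone,
    withDensity_apply _ (hg.measurableSet_coneOver hE), smul_eq_mul]

-- By Euler's identity 1 = Dg(x) x ≤ ‖Dg(x)‖ ‖x‖, and ‖x‖ ≤ 1/c on the level set. This keeps the
-- approximating hyperplanes at bounded distance from the origin.
omit [FiniteDimensional ℝ V] [MeasurableSpace V] [BorelSpace V] in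
theorem le_norm_fderiv {x : V} (hx : DifferentiableAt ℝ g x) (hgx : g x = 1) :
    c ≤ ‖fderiv ℝ g x‖ := by
  have h1 := hg.fderiv_apply_self hx
  have h2 := (fderiv ℝ g x).le_opNorm x
  rw [h1, hgx, norm_one] at h2
  have h3 : ‖fderiv ℝ g x‖ * ‖x‖ ≤ ‖fderiv ℝ g x‖ * c⁻¹ := by
    gcongr; exact hg.norm_le_of_eq_one hgx
  have hc := hg.pos
  rw [← div_eq_mul_inv] at h3
  exact (one_le_div hc).1 (h2.trans h3)

/-- Comparison of the area and of the cone measure on a set on which `g` is almost linear. -/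
theorem area_comparison_of_approx {E : Set V} (hEm : MeasurableSet E) (hE : ∀ x ∈ E, g x = 1)
    (hdiff : ∀ x ∈ E, DifferentiableAt ℝ g x)
    {y : V} (hy : DifferentiableAt ℝ g y) (hgy : g y = 1) {δ : ℝ≥0} {η : ℝ}
    (hη1 : η < 1) (hδ1 : (δ / c * L + δ * (1 + L / c)) / c ≤ η) (hδ2 : δ / c ≤ η)
    (hA : ApproximatesLinearOn g (fderiv ℝ g y) E δ)
    (hA' : ∀ x ∈ E, ‖fderiv ℝ g x - fderiv ℝ g y‖ ≤ δ) :
    μHE[finrank ℝ V - 1] E ≤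
        ENNReal.ofReal (((1 + η) / (1 - η)) ^ (finrank ℝ V + 1)) * coneMeasure g E ∧
      coneMeasure g E ≤
        ENNReal.ofReal (((1 + η) / (1 - η)) ^ (finrank ℝ V + 1)) * μHE[finrank ℝ V - 1] E := by
  have hc := hg.pos
  have hη0 : 0 ≤ η := le_trans (by positivity) hδ2
  have h1η : 0 < 1 - η := by linarith
  set A := fderiv ℝ g y with hAdef
  have hcA : c ≤ ‖A‖ := hg.le_norm_fderiv hy hgy
  have hApos : 0 < ‖A‖ := hc.trans_le hcA
  set w : V := (InnerProductSpace.toDual ℝ V).symm A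
  have hw : ∀ z, ⟪w, z⟫ = A z := fun z ↦ InnerProductSpace.toDual_symm_apply
  have hwn : ‖w‖ = ‖A‖ := LinearIsometryEquiv.norm_map _ _
  -- The model hyperplane is {A = 1}, with unit normal `v` and height `‖A‖⁻¹`.
  set v : V := ‖A‖⁻¹ • w
  have hv : ‖v‖ = 1 := by
    rw [norm_smul, hwn, norm_inv, norm_norm, inv_mul_cancel₀ hApos.ne']
  have hvz : ∀ z, ⟪v, z⟫ = ‖A‖⁻¹ * A z := fun z ↦ by rw [real_inner_smul_left, hw]
  have hAx : ∀ x ∈ E, |A x - 1| ≤ δ / c := by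
    intro x hx
    have h1 : A x - 1 = -((fderiv ℝ g x - A) x) := by
      rw [_root_.sub_apply, hg.fderiv_apply_self (hdiff x hx), hE x hx]; ring
    rw [h1, abs_neg, ← Real.norm_eq_abs, div_eq_mul_inv]
    exact ((fderiv ℝ g x - A).le_opNorm x).trans
      (mul_le_mul (hA' x hx) (hg.norm_le_of_eq_one (hE x hx)) (norm_nonneg _) δ.2)
  have happ : ∀ t t' : ℝ, 0 < t → 0 < t' → ∀ x ∈ E, ∀ x' ∈ E,
      |‖A‖⁻¹ * (g (t • x) - g (t' • x')) - ⟪v, t • x - t' • x'⟫| ≤ η * ‖t • x - t' • x'‖ := by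
    intro t t' ht ht' x hx x' hx'
    rw [hvz, ← mul_sub, abs_mul, abs_of_pos (inv_pos.2 hApos)]
    calc _ ≤ c⁻¹ * ((δ / c * L + δ * (1 + L / c)) * ‖t • x - t' • x'‖) := by
          gcongr
          exact hg.approx_cone hE hA hAx ht ht' hx hx'
      _ = ((δ / c * L + δ * (1 + L / c)) / c) * ‖t • x - t' • x'‖ := by ring
      _ ≤ _ := by gcongr
  obtain ⟨k1, k2⟩ := hg.cone_comparison hEm hE hv (inv_pos.2 hApos) hη0 hη1 happ
  have hnt : Nontrivial V := ⟨v, 0, by rintro h; simp [h] at hv⟩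
  have hd : 0 < finrank ℝ V := finrank_pos
  have hdR : (0 : ℝ) < finrank ℝ V := by exact_mod_cast hd
  -- The weight |∇g| ≈ ‖A‖ of the cone measure cancels the height `‖A‖⁻¹` in the volume of the cone.
  have hmul : (finrank ℝ V : ℝ≥0∞) * ENNReal.ofReal ‖A‖ *
      ENNReal.ofReal (‖A‖⁻¹ / finrank ℝ V) = 1 := by
    rw [← ENNReal.ofReal_natCast, ← ENNReal.ofReal_mul (by positivity),
      ← ENNReal.ofReal_mul (by positivity), ← ENNReal.ofReal_one]
    congr 1
    field_simp
  have hδA : (δ : ℝ) ≤ η * ‖A‖ := by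
    rw [div_le_iff₀ hc] at hδ2
    exact hδ2.trans (by gcongr)
  -- The derivative is constant along rays, so closeness on `E` spreads to the cone. Replacing |∇g|
  -- by ‖A‖ costs the additional factor in the exponent d + 1.
  have hpt : ∀ z ∈ coneOver g E, (1 - η) * ‖A‖ ≤ ‖fderiv ℝ g z‖ ∧
      ‖fderiv ℝ g z‖ ≤ (1 + η) * ‖A‖ := by
    rintro z ⟨hz0, hz1, hz⟩
    have h1 := hA' _ hz
    rw [hg.fderiv_smul (inv_pos.2 hz0)] at h1
    have h2 := abs_le.1 ((abs_norm_sub_norm_le _ _).trans h1)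
    constructor <;> linarith [h2.1, h2.2]
  have hcm := hg.measurableSet_coneOver hEm
  have hup : ∫⁻ z in coneOver g E, ‖fderiv ℝ g z‖ₑ ≤
      ENNReal.ofReal ((1 + η) * ‖A‖) * volume (coneOver g E) := by
    rw [← setLIntegral_const]
    refine setLIntegral_mono measurable_const fun z hz ↦ ?_
    rw [← ofReal_norm]
    exact ENNReal.ofReal_le_ofReal (hpt z hz).2
  have hlow : ENNReal.ofReal ((1 - η) * ‖A‖) * volume (coneOver g E) ≤
      ∫⁻ z in coneOver g E, ‖fderiv ℝ g z‖ₑ := by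
    rw [← setLIntegral_const]
    refine setLIntegral_mono' hcm fun z hz ↦ ?_
    rw [← ofReal_norm]
    exact ENNReal.ofReal_le_ofReal (hpt z hz).1
  set Q := (1 + η) / (1 - η) with hQ
  have hQ0 : 0 ≤ Q := by positivity
  rw [hg.coneMeasure_apply hEm, pow_succ, ENNReal.ofReal_mul (by positivity)]
  set H := μHE[finrank ℝ V - 1] E
  set vol := volume (coneOver g E)
  set I := ∫⁻ z in coneOver g E, ‖fderiv ℝ g z‖ₑ
  set q := ENNReal.ofReal (Q ^ finrank ℝ V)
  constructor
  · have h1 : ENNReal.ofReal ‖A‖ * vol ≤ ENNReal.ofReal Q * I := by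
      calc _ ≤ ENNReal.ofReal (Q * ((1 - η) * ‖A‖)) * vol := by
            gcongr
            have : Q * (1 - η) = 1 + η := div_mul_cancel₀ _ h1η.ne'
            nlinarith
        _ = ENNReal.ofReal Q * (ENNReal.ofReal ((1 - η) * ‖A‖) * vol) := by
            rw [ENNReal.ofReal_mul hQ0, mul_assoc]
        _ ≤ _ := by gcongr
    calc H = (finrank ℝ V : ℝ≥0∞) * ENNReal.ofReal ‖A‖ *
        (ENNReal.ofReal (‖A‖⁻¹ / finrank ℝ V) * H) := by rw [← mul_assoc, hmul, one_mul]
      _ ≤ (finrank ℝ V : ℝ≥0∞) * ENNReal.ofReal ‖A‖ * (q * vol) := by gcongr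
      _ = (finrank ℝ V : ℝ≥0∞) * q * (ENNReal.ofReal ‖A‖ * vol) := by ring
      _ ≤ (finrank ℝ V : ℝ≥0∞) * q * (ENNReal.ofReal Q * I) := by gcongr
      _ = _ := by ring
  · calc finrank ℝ V * I ≤ finrank ℝ V * (ENNReal.ofReal ((1 + η) * ‖A‖) * vol) := by gcongr
      _ ≤ finrank ℝ V * (ENNReal.ofReal (Q * ‖A‖) * (q *
          (ENNReal.ofReal (‖A‖⁻¹ / finrank ℝ V) * H))) := by
          gcongr
          rw [hQ, le_div_iff₀ h1η]
          nlinarith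
      _ = (finrank ℝ V * ENNReal.ofReal ‖A‖ * ENNReal.ofReal (‖A‖⁻¹ / finrank ℝ V)) *
          (q * ENNReal.ofReal Q * H) := by
          rw [ENNReal.ofReal_mul hQ0]; ring
      _ = _ := by rw [hmul, one_mul]

theorem area_comparison {η : ℝ} (hη0 : 0 < η) (hη1 : η < 1) {E : Set V} (hEm : MeasurableSet E)
    (hE : ∀ x ∈ E, g x = 1) (hdiff : ∀ x ∈ E, DifferentiableAt ℝ g x) :
    μHE[finrank ℝ V - 1] E ≤
        ENNReal.ofReal (((1 + η) / (1 - η)) ^ (finrank ℝ V + 1)) * coneMeasure g E ∧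
      coneMeasure g E ≤
        ENNReal.ofReal (((1 + η) / (1 - η)) ^ (finrank ℝ V + 1)) * μHE[finrank ℝ V - 1] E := by
  have hc := hg.pos
  obtain ⟨δ, hδ0, hδ1, hδ2⟩ : ∃ δ : ℝ, 0 < δ ∧
      (δ / c * L + δ * (1 + L / c)) / c ≤ η ∧ δ / c ≤ η := by
    -- The first condition is linear in δ, with slope `C`.
    set C := (1 / c * L + 1 * (1 + L / c)) / c
    have hC : 0 < C := by positivity
    refine ⟨min (η / C) (η * c), lt_min (by positivity) (by positivity), ?_, ?_⟩
    · calc _ = min (η / C) (η * c) * C := by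
            simp only [C]; ring
        _ ≤ η / C * C := by gcongr; exact min_le_left _ _
        _ = η := by field_simp
    · rw [div_le_iff₀ hc]; exact min_le_right _ _
  lift δ to ℝ≥0 using hδ0.le
  replace hδ0 : 0 < δ := by exact_mod_cast hδ0
  set G : Set V := {x | g x = 1 ∧ DifferentiableAt ℝ g x} with hG
  have hGm : MeasurableSet G :=
    (hg.continuous.measurable (measurableSet_singleton 1)).inter
      (measurableSet_of_differentiableAt ℝ g)
  -- The derivative need not be continuous. Sorting points by a ball of radius δ/2 containing their
  -- derivative makes any two derivatives in the same class δ-close; each class is then partitioned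
  -- into pieces on which `g` is δ-close to linear.
  set D := TopologicalSpace.denseSeq (V →L[ℝ] ℝ)
  set s : ℕ → Set V := fun j ↦ G ∩ {x | fderiv ℝ g x ∈ ball (D j) (δ / 2)}
  have hsm : ∀ j, MeasurableSet (s j) := fun j ↦
    hGm.inter ((measurable_fderiv ℝ g) measurableSet_ball)
  have hcover := fun j ↦ exists_partition_approximatesLinearOn_of_hasFDerivWithinAt g (s j)
    (fderiv ℝ g) (fun x hx ↦ hx.1.2.hasFDerivAt.hasFDerivWithinAt) (fun _ ↦ δ)
    (fun _ ↦ hδ0.ne')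
  choose t A _ htm hst hApp hAy using hcover
  have hloc : ∀ p : ℕ × ℕ, ∀ F ⊆ s p.1 ∩ t p.1 p.2, MeasurableSet F →
      μHE[finrank ℝ V - 1] F ≤
        ENNReal.ofReal (((1 + η) / (1 - η)) ^ (finrank ℝ V + 1)) * coneMeasure g F ∧
      coneMeasure g F ≤
        ENNReal.ofReal (((1 + η) / (1 - η)) ^ (finrank ℝ V + 1)) * μHE[finrank ℝ V - 1] F := by
    rintro ⟨j, k⟩ F hF hFm
    rcases F.eq_empty_or_nonempty with rfl | ⟨x₀, hx₀⟩
    · simp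
    obtain ⟨y, hy, hyA⟩ := hAy j ⟨x₀, (hF hx₀).1⟩ k
    refine hg.area_comparison_of_approx hFm (fun x hx ↦ (hF hx).1.1.1)
      (fun x hx ↦ (hF hx).1.1.2) hy.1.2 hy.1.1 hη1 hδ1 hδ2 ?_ ?_
    · rw [← hyA]; exact (hApp j k).mono_set hF
    · intro x hx
      have h1 : dist (fderiv ℝ g x) (D j) < δ / 2 := (hF hx).1.2
      have h2 : dist (fderiv ℝ g y) (D j) < δ / 2 := hy.2
      rw [← dist_eq_norm]
      linarith [dist_triangle_right (fderiv ℝ g x) (fderiv ℝ g y) (D j)]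
  have hU : ∀ p : ℕ × ℕ, MeasurableSet (s p.1 ∩ t p.1 p.2) := fun p ↦
    (hsm p.1).inter (htm p.1 p.2)
  have hGU : G ⊆ ⋃ p : ℕ × ℕ, s p.1 ∩ t p.1 p.2 := by
    intro x hx
    obtain ⟨j, hj⟩ := (TopologicalSpace.denseRange_denseSeq (V →L[ℝ] ℝ)).exists_dist_lt
      (fderiv ℝ g x) (ε := δ / 2) (by positivity)
    have hxs : x ∈ s j := ⟨hx, hj⟩
    obtain ⟨k, hk⟩ := mem_iUnion.1 (hst j hxs)
    exact mem_iUnion.2 ⟨(j, k), hxs, hk⟩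
  have hEG : E ⊆ G := fun x hx ↦ ⟨hE x hx, hdiff x hx⟩
  constructor
  · exact measure_le_of_countable_cover
      (ν := ENNReal.ofReal (((1 + η) / (1 - η)) ^ (finrank ℝ V + 1)) • coneMeasure g)
      hU hGU (fun p F hF hFm ↦ (hloc p F hF hFm).1) hEm hEG
  · exact measure_le_of_countable_cover
      (ν := ENNReal.ofReal (((1 + η) / (1 - η)) ^ (finrank ℝ V + 1)) • μHE[finrank ℝ V - 1])
      hU hGU (fun p F hF hFm ↦ (hloc p F hF hFm).2) hEm hEG

theorem area_eq_coneMeasure {E : Set V} (hEm : MeasurableSet E)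
    (hE : ∀ x ∈ E, g x = 1) (hdiff : ∀ x ∈ E, DifferentiableAt ℝ g x) :
    μHE[finrank ℝ V - 1] E = coneMeasure g E := by
  have key : Tendsto (fun η : ℝ ↦ ENNReal.ofReal (((1 + η) / (1 - η)) ^ (finrank ℝ V + 1)))
      (𝓝[>] 0) (𝓝 1) := by
    have : ContinuousAt (fun η : ℝ ↦ ENNReal.ofReal (((1 + η) / (1 - η)) ^ (finrank ℝ V + 1))) 0 :=
      ENNReal.continuous_ofReal.continuousAt.comp
        (ContinuousAt.pow (ContinuousAt.div (by fun_prop) (by fun_prop) (by simp)) _)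
    have h2 := this.tendsto
    simp only [add_zero, sub_zero, div_one, one_pow, ENNReal.ofReal_one] at h2
    exact h2.mono_left nhdsWithin_le_nhds
  have hev : ∀ᶠ η : ℝ in 𝓝[>] 0, 0 < η ∧ η < 1 := by
    filter_upwards [Ioo_mem_nhdsGT (zero_lt_one' ℝ)] with η hη using hη
  refine le_antisymm ?_ ?_
  · refine ge_of_tendsto (f := fun η : ℝ ↦ _) ?_
      (hev.mono fun η hη ↦ (hg.area_comparison hη.1 hη.2 hEm hE hdiff).1)
    simpa using ENNReal.Tendsto.mul_const key (Or.inl one_ne_zero)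
  · refine ge_of_tendsto (f := fun η : ℝ ↦ _) ?_
      (hev.mono fun η hη ↦ (hg.area_comparison hη.1 hη.2 hEm hE hdiff).2)
    simpa using ENNReal.Tendsto.mul_const key (Or.inl one_ne_zero)

end IsGauge

end

/-! ### The non-differentiable part, and the full area formula for level sets -/

section

variable {V : Type*} [NormedAddCommGroup V] [InnerProductSpace ℝ V] [FiniteDimensional ℝ V]
  [MeasurableSpace V] [BorelSpace V]

namespace IsGauge

variable {g : V → ℝ} {c : ℝ} {L : ℝ≥0} (hg : IsGauge g c L)
include hg

omit [FiniteDimensional ℝ V] [MeasurableSpace V] [BorelSpace V] in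
theorem lipschitzOnWith_radial {m M : ℝ} (hm : 0 < m) {W : Set V}
    (hW : ∀ y ∈ W, m ≤ g y) (hWM : ∀ y ∈ W, ‖y‖ ≤ M) :
    LipschitzOnWith (m⁻¹ + M * L / m ^ 2).toNNReal (fun y ↦ (g y)⁻¹ • y) W := by
  refine LipschitzOnWith.of_dist_le_mul fun y hy y' hy' ↦ ?_
  have h1 := hW y hy
  have h2 := hW y' hy'
  have h1' : 0 < g y := hm.trans_le h1
  have h2' : 0 < g y' := hm.trans_le h2
  have hM : 0 ≤ M := (norm_nonneg _).trans (hWM y hy)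
  rw [Real.coe_toNNReal _ (by positivity), dist_eq_norm, dist_eq_norm]
  have e : (g y)⁻¹ • y - (g y')⁻¹ • y' =
      (g y)⁻¹ • (y - y') + ((g y' - g y) / (g y * g y')) • y' := by
    have : (g y' - g y) / (g y * g y') = (g y)⁻¹ - (g y')⁻¹ := by field_simp
    rw [this]; module
  rw [e]
  calc _ ≤ ‖(g y)⁻¹ • (y - y')‖ + ‖((g y' - g y) / (g y * g y')) • y'‖ := norm_add_le _ _
    _ = (g y)⁻¹ * ‖y - y'‖ + |g y' - g y| / (g y * g y') * ‖y'‖ := by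
        rw [norm_smul, norm_smul, norm_div, Real.norm_of_nonneg (inv_nonneg.2 h1'.le),
          Real.norm_eq_abs, Real.norm_of_nonneg (by positivity : 0 ≤ g y * g y')]
    _ ≤ m⁻¹ * ‖y - y'‖ + (L * ‖y - y'‖) / (m * m) * M := by
        have := hg.abs_sub_le y' y
        rw [norm_sub_rev] at this
        gcongr
        exact hWM y' hy'
    _ = _ := by ring

/-- A subset of the level set `g = 1` has area zero if the cone over it is a null set. -/
theorem area_eq_zero_of_cone_halfspace {E : Set V} (hEm : MeasurableSet E)
    (hE : ∀ x ∈ E, g x = 1) (hnull : volume (Ioi (0 : ℝ) • E) = 0) {v : V} (hv : ‖v‖ = 1) {a : ℝ}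
    (ha : 0 < a) (hEa : ∀ x ∈ E, a ≤ ⟪v, x⟫) : μHE[finrank ℝ V - 1] E = 0 := by
  have hc := hg.pos
  -- The radial projection of `E` to a hyperplane. The cone over it is null, so the flat cone
  -- formula gives `W` area zero; the half-space condition makes `W` bounded, so projecting back to
  -- the level set is Lipschitz.
  set W : Set V := {y | ⟪v, y⟫ = 1 ∧ 0 < g y ∧ (g y)⁻¹ • y ∈ E}
  have hgm := hg.continuous.measurable
  have hWm : MeasurableSet W :=
    ((by fun_prop : Measurable fun y : V ↦ ⟪v, y⟫) (measurableSet_singleton 1)).inter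
      ((measurableSet_lt measurable_const hgm).inter
        ((by fun_prop : Measurable fun y ↦ (g y)⁻¹ • y) hEm))
  have hvW : ∀ y ∈ W, 1 ≤ ‖y‖ := by
    rintro y ⟨h1, -⟩
    have := real_inner_le_norm v y
    rwa [h1, hv, one_mul] at this
  have hWg : ∀ y ∈ W, c ≤ g y := fun y hy ↦ by
    have := hg.le y
    nlinarith [hvW y hy]
  have hWM : ∀ y ∈ W, ‖y‖ ≤ a⁻¹ * c⁻¹ := by
    rintro y ⟨h1, h2, h3⟩
    have h4 := hEa _ h3
    rw [inner_smul_right, h1, mul_one] at h4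
    have h5 := hg.norm_le_of_eq_one (hE _ h3)
    rw [norm_smul, norm_inv, Real.norm_of_nonneg h2.le] at h5
    have h6 : g y ≤ a⁻¹ := (le_inv_comm₀ ha h2).1 h4
    calc ‖y‖ = g y * ((g y)⁻¹ * ‖y‖) := by field_simp
      _ ≤ _ := by gcongr
  have himg : E ⊆ (fun y ↦ (g y)⁻¹ • y) '' W := by
    intro x hx
    have hi : 0 < ⟪v, x⟫ := ha.trans_le (hEa x hx)
    have hgi : g (⟪v, x⟫⁻¹ • x) = ⟪v, x⟫⁻¹ := by
      rw [hg.map_smul _ (inv_pos.2 hi), hE x hx, mul_one]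
    have e : (g (⟪v, x⟫⁻¹ • x))⁻¹ • ⟪v, x⟫⁻¹ • x = x := by
      rw [hgi, inv_inv, smul_smul, mul_inv_cancel₀ hi.ne', one_smul]
    refine ⟨⟪v, x⟫⁻¹ • x, ⟨?_, ?_, ?_⟩, e⟩
    · rw [inner_smul_right, inv_mul_cancel₀ hi.ne']
    · rw [hgi]; positivity
    · rwa [e]
  have hcone : volume (Ioo (0 : ℝ) 1 • W) = 0 := by
    refine measure_mono_null ?_ hnull
    rintro _ ⟨t, ht, y, ⟨-, h2, h3⟩, rfl⟩
    refine ⟨t * g y, mul_pos ht.1 h2, _, h3, ?_⟩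
    simp [smul_smul, h2.ne']
  rw [volume_cone_flat hv one_pos hWm fun y hy ↦ hy.1, mul_eq_zero] at hcone
  have hnt : Nontrivial V := ⟨v, 0, by rintro h; simp [h] at hv⟩
  have hd : (0 : ℝ) < finrank ℝ V := by exact_mod_cast finrank_pos (R := ℝ) (M := V)
  have hW0 : μHE[finrank ℝ V - 1] W = 0 := hcone.resolve_left (by
    rw [ENNReal.ofReal_eq_zero, not_le]; positivity)
  refine measure_mono_null himg (le_antisymm ?_ zero_le)
  refine (euclideanHausdorffMeasure_image_le (hg.lipschitzOnWith_radial hc hWg hWM) _).trans ?_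
  rw [hW0, mul_zero]

/-- A point of the level set is nonzero, hence has a nonzero coordinate in an orthonormal basis. So
the half-spaces ⟪±bᵢ, x⟫ ≥ 1/(k+1) form a countable cover of `E`. -/
theorem area_eq_zero_of_cone {E : Set V} (hEm : MeasurableSet E)
    (hE : ∀ x ∈ E, g x = 1) (hnull : volume (Ioi (0 : ℝ) • E) = 0) :
    μHE[finrank ℝ V - 1] E = 0 := by
  set b := stdOrthonormalBasis ℝ V
  have key : ∀ v : V, ‖v‖ = 1 → ∀ k : ℕ,
      μHE[finrank ℝ V - 1] (E ∩ {x | (1 / (k + 1 : ℝ)) ≤ ⟪v, x⟫}) = 0 := by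
    intro v hv k
    refine hg.area_eq_zero_of_cone_halfspace (hEm.inter ?_) (fun x hx ↦ hE x hx.1)
      (measure_mono_null (smul_subset_smul_left inter_subset_left) hnull) hv
      (a := 1 / (k + 1 : ℝ)) (by positivity) (fun x hx ↦ hx.2)
    exact measurableSet_le measurable_const (by fun_prop)
  have hpos : ∀ v : V, ‖v‖ = 1 → μHE[finrank ℝ V - 1] (E ∩ {x | 0 < ⟪v, x⟫}) = 0 := by
    intro v hv
    refine measure_mono_null ?_ (measure_iUnion_null (key v hv))
    rintro x ⟨hx, hx0⟩
    obtain ⟨k, hk⟩ := exists_nat_one_div_lt (show (0 : ℝ) < ⟪v, x⟫ from hx0)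
    exact mem_iUnion.2 ⟨k, hx, hk.le⟩
  have hall : ∀ i, μHE[finrank ℝ V - 1] (E ∩ {x | 0 < ⟪b i, x⟫} ∪ E ∩ {x | 0 < ⟪-b i, x⟫}) = 0 :=
    fun i ↦ measure_union_null (hpos _ (b.norm_eq_one i))
      (hpos _ (by rw [norm_neg]; exact b.norm_eq_one i))
  refine measure_mono_null ?_ (measure_iUnion_null hall)
  intro x hx
  have hx0 : x ≠ 0 := by
    rintro rfl
    have := hE _ hx
    rw [hg.map_zero] at this
    exact zero_ne_one this
  obtain ⟨i, hi⟩ : ∃ i, ⟪b i, x⟫ ≠ 0 := by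
    by_contra! h
    exact hx0 (by rw [← b.sum_repr' x]; simp [h])
  refine mem_iUnion.2 ⟨i, ?_⟩
  rcases lt_or_gt_of_ne hi with h | h
  · right; exact ⟨hx, by simpa [inner_neg_left] using h⟩
  · left; exact ⟨hx, h⟩

/-- The area of the level set `g = 1` of a gauge is `d ∫_{g < 1} |∇g|`. -/
theorem area_level_set [Nontrivial V] : μHE[finrank ℝ V - 1] {x | g x = 1} =
    finrank ℝ V * ∫⁻ z in {z | g z < 1}, ‖fderiv ℝ g z‖ₑ := by
  have hgm := hg.continuous.measurable
  have hlev : MeasurableSet {x | g x = 1} := hgm (measurableSet_singleton 1)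
  -- Null by Rademacher's theorem and invariant under positive scaling, hence it contains the
  -- infinite cone over its part of the level set.
  set N : Set V := {x | ¬ DifferentiableAt ℝ g x}
  have hNm : MeasurableSet N := (measurableSet_of_differentiableAt ℝ g).compl
  have hN : volume N = 0 := hg.lipschitz.ae_differentiableAt
  have hbad : μHE[finrank ℝ V - 1] ({x | g x = 1} ∩ N) = 0 := by
    refine hg.area_eq_zero_of_cone (hlev.inter hNm) (fun x hx ↦ hx.1) (measure_mono_null ?_ hN)
    rintro _ ⟨t, ht, x, ⟨-, hx⟩, rfl⟩ hd
    refine hx ?_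
    have := hg.differentiableAt_smul (inv_pos.2 ht) hd
    simpa [smul_smul, (show (t : ℝ) ≠ 0 from (ne_of_gt ht))] using this
  have hgood : MeasurableSet ({x | g x = 1} \ N) := hlev.diff hNm
  have h1 := hg.area_eq_coneMeasure hgood (fun x hx ↦ hx.1) (fun x hx ↦ not_not.1 hx.2)
  rw [hg.coneMeasure_apply hgood] at h1
  rw [← measure_inter_add_sdiff _ hNm, hbad, zero_add, h1]
  congr 1
  refine setLIntegral_congr ?_
  have hN0 : ∀ᵐ z : V, z ∉ N ∧ z ≠ 0 := by
    exact (measure_eq_zero_iff_ae_notMem.1 hN).and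
      (measure_eq_zero_iff_ae_notMem.1 (measure_singleton (0 : V)))
  filter_upwards [hN0] with z hz
  refine propext ⟨fun h ↦ h.2.1, fun h ↦ ?_⟩
  have hz0 := hg.pos_of_ne hz.2
  refine ⟨hz0, h, ?_, ?_⟩
  · show g _ = 1
    rw [hg.map_smul _ (inv_pos.2 hz0), inv_mul_cancel₀ hz0.ne']
  · exact fun h' ↦ h' (hg.differentiableAt_smul (inv_pos.2 hz0) (not_not.1 hz.1))

end IsGauge

end

section

/-! ### The Prékopa–Leindler and Brunn–Minkowski inequalities -/

/-- With a₁ = max A and b₀ = min B, the set C contains sA + t b₀ and s a₁ + tB, which meet only in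
the point s a₁ + t b₀. -/
theorem brunnMinkowski_real_compact {A B C : Set ℝ} (hA : IsCompact A) (hB : IsCompact B)
    (hA0 : A.Nonempty) (hB0 : B.Nonempty) {s t : ℝ} (hs : 0 < s) (ht : 0 < t)
    (hC : ∀ a ∈ A, ∀ b ∈ B, s * a + t * b ∈ C) :
    ENNReal.ofReal s * volume A + ENNReal.ofReal t * volume B ≤ volume C := by
  obtain ⟨a₁, ha₁, hmax⟩ := hA.exists_isGreatest hA0
  obtain ⟨b₀, hb₀, hmin⟩ := hB.exists_isLeast hB0
  set X : Set ℝ := (t * b₀) +ᵥ (s • A)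
  set Y : Set ℝ := (s * a₁) +ᵥ (t • B)
  have hX : volume X = ENNReal.ofReal s * volume A := by
    rw [measure_vadd, addHaar_smul_of_nonneg _ hs.le]; simp
  have hY : volume Y = ENNReal.ofReal t * volume B := by
    rw [measure_vadd, addHaar_smul_of_nonneg _ ht.le]; simp
  have hYm : MeasurableSet Y := ((hB.smul t).vadd (s * a₁)).measurableSet
  have hXY : AEDisjoint volume X Y := by
    refine measure_mono_null ?_ (measure_singleton (s * a₁ + t * b₀))
    rintro _ ⟨⟨_, ⟨a, ha, rfl⟩, rfl⟩, ⟨_, ⟨b, hb, rfl⟩, h⟩⟩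
    have h1 := hmax ha
    have h2 := hmin hb
    simp only [smul_eq_mul, vadd_eq_add, mem_singleton_iff] at h ⊢
    nlinarith
  rw [← hX, ← hY, ← measure_union₀ hYm.nullMeasurableSet hXY]
  refine measure_mono (union_subset ?_ ?_)
  · rintro _ ⟨_, ⟨a, ha, rfl⟩, rfl⟩
    have := hC a ha b₀ hb₀
    simpa [add_comm] using this
  · rintro _ ⟨_, ⟨b, hb, rfl⟩, rfl⟩
    simpa using hC a₁ ha₁ b hb

theorem brunnMinkowski_real {A B C : Set ℝ} (hA : MeasurableSet A) (hB : MeasurableSet B)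
    (hA0 : A.Nonempty) (hB0 : B.Nonempty) {s t : ℝ} (hs : 0 < s) (ht : 0 < t)
    (hC : ∀ a ∈ A, ∀ b ∈ B, s * a + t * b ∈ C) :
    ENNReal.ofReal s * volume A + ENNReal.ofReal t * volume B ≤ volume C := by
  obtain ⟨a, ha⟩ := hA0
  obtain ⟨b, hb⟩ := hB0
  have key : ∀ K ⊆ A, IsCompact K → ∀ K' ⊆ B, IsCompact K' →
      ENNReal.ofReal s * volume K + ENNReal.ofReal t * volume K' ≤ volume C := by
    intro K hK hKc K' hK' hKc'
    -- Adjoining a point keeps the approximating compact sets nonempty.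
    have h1 : K ∪ {a} ⊆ A := union_subset hK (singleton_subset_iff.2 ha)
    have h2 : K' ∪ {b} ⊆ B := union_subset hK' (singleton_subset_iff.2 hb)
    calc _ ≤ ENNReal.ofReal s * volume (K ∪ {a}) + ENNReal.ofReal t * volume (K' ∪ {b}) := by
          gcongr <;> exact subset_union_left
      _ ≤ _ := brunnMinkowski_real_compact (hKc.union isCompact_singleton)
          (hKc'.union isCompact_singleton) ⟨a, by simp⟩ ⟨b, by simp⟩ hs ht
          fun x hx y hy ↦ hC x (h1 hx) y (h2 hy)
  rw [hA.measure_eq_iSup_isCompact, hB.measure_eq_iSup_isCompact]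
  simp only [iSup_and', iSup_subtype', ENNReal.mul_iSup]
  have : Nonempty {K : Set ℝ // K ⊆ A ∧ IsCompact K} := ⟨∅, by simp⟩
  have : Nonempty {K : Set ℝ // K ⊆ B ∧ IsCompact K} := ⟨∅, by simp⟩
  exact ENNReal.iSup_add_iSup_le fun K K' ↦ key K.1 K.2.1 K.2.2 K'.1 K'.2.1 K'.2.2

theorem rpow_mul_rpow_le_add {s t : ℝ} (hs : 0 < s) (ht : 0 < t) (hst : s + t = 1)
    (x y : ℝ≥0∞) : x ^ s * y ^ t ≤ ENNReal.ofReal s * x + ENNReal.ofReal t * y := by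
  have hpq : (s⁻¹).HolderConjugate t⁻¹ := by
    rw [Real.holderConjugate_iff]
    exact ⟨(one_lt_inv₀ hs).2 (by linarith), by simpa using hst⟩
  have := ENNReal.young_inequality (x ^ s) (y ^ t) hpq
  rw [← ENNReal.rpow_mul, ← ENNReal.rpow_mul, mul_inv_cancel₀ hs.ne', mul_inv_cancel₀ ht.ne',
    ENNReal.rpow_one, ENNReal.rpow_one, ENNReal.ofReal_inv_of_pos hs, ENNReal.ofReal_inv_of_pos ht,
    div_eq_mul_inv, div_eq_mul_inv, inv_inv, inv_inv] at this
  rwa [mul_comm (ENNReal.ofReal s), mul_comm (ENNReal.ofReal t)]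

/-- Layer cake; the minimum with 1 is there because the majorant `h` below need not be bounded. -/
theorem lintegral_meas_lt_unit {φ : ℝ → ℝ≥0∞} (hφ : Measurable φ) :
    ∫⁻ r in Ioo (0 : ℝ) 1, volume {x | ENNReal.ofReal r < φ x} = ∫⁻ x, min (φ x) 1 := by
  have hfin : ∀ x, min (φ x) 1 ≠ ∞ := fun x ↦
    ne_top_of_le_ne_top ENNReal.one_ne_top (min_le_right _ _)
  have h1 : ∫⁻ x, min (φ x) 1 = ∫⁻ x, ENNReal.ofReal (min (φ x) 1).toReal :=
    lintegral_congr fun x ↦ (ENNReal.ofReal_toReal (hfin x)).symm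
  rw [h1, lintegral_eq_lintegral_meas_lt volume (Eventually.of_forall fun x ↦ ENNReal.toReal_nonneg)
    (hφ.min measurable_const).ennreal_toReal.aemeasurable,
    ← lintegral_indicator measurableSet_Ioo, ← lintegral_indicator measurableSet_Ioi]
  congr 1
  ext r
  by_cases hr0 : 0 < r
  · have hset : {x | r < (min (φ x) 1).toReal} = {x | ENNReal.ofReal r < min (φ x) 1} := by
      ext x
      exact (ENNReal.ofReal_lt_iff_lt_toReal hr0.le (hfin x)).symm
    rw [indicator_of_mem (mem_Ioi.2 hr0), hset]
    by_cases hr1 : r < 1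
    · rw [indicator_of_mem (mem_Ioo.2 ⟨hr0, hr1⟩)]
      simp [hr1]
    · rw [indicator_of_notMem fun h ↦ hr1 h.2]
      simp [hr1]
  · rw [indicator_of_notMem fun h ↦ hr0 h.1, indicator_of_notMem (mt mem_Ioi.1 hr0)]

/-- With both suprema equal to 1, the sets {f > r} and {g > r} are nonempty for every r < 1, and s{f
> r} + t{g > r} lies in {h > r}. One-dimensional Brunn–Minkowski integrated over r gives s∫f + t∫g ≤
∫h, stronger than the claim by weighted AM–GM. -/
theorem prekopaLeindler_real_normalized {s t : ℝ} (hs : 0 < s) (ht : 0 < t) (hst : s + t = 1)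
    {f g h : ℝ → ℝ≥0∞} (hf : Measurable f) (hg : Measurable g) (hh : Measurable h)
    (hf1 : ∀ x, f x ≤ 1) (hg1 : ∀ x, g x ≤ 1)
    (hf0 : ∀ r < 1, ∃ x, r < f x) (hg0 : ∀ r < 1, ∃ x, r < g x)
    (hfgh : ∀ x y, f x ^ s * g y ^ t ≤ h (s * x + t * y)) :
    (∫⁻ x, f x) ^ s * (∫⁻ x, g x) ^ t ≤ ∫⁻ x, h x := by
  refine (rpow_mul_rpow_le_add hs ht hst _ _).trans ?_
  have e1 := lintegral_meas_lt_unit hf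
  have e2 := lintegral_meas_lt_unit hg
  have e3 := lintegral_meas_lt_unit hh
  simp only [min_eq_left (hf1 _), min_eq_left (hg1 _)] at e1 e2
  have hanti : ∀ φ : ℝ → ℝ≥0∞, Measurable fun r : ℝ ↦ volume {x | ENNReal.ofReal r < φ x} := by
    intro φ
    refine Antitone.measurable fun r r' hr ↦ measure_mono fun x hx ↦ ?_
    exact lt_of_le_of_lt (ENNReal.ofReal_le_ofReal hr) hx
  rw [← e1, ← e2, ← lintegral_const_mul _ (hanti f), ← lintegral_const_mul _ (hanti g),
    ← lintegral_add_left ((hanti f).const_mul _)]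
  refine le_trans ?_ (lintegral_mono fun x ↦ min_le_left (h x) 1)
  rw [← e3]
  refine setLIntegral_mono' measurableSet_Ioo fun r hr ↦ ?_
  have hr1 : ENNReal.ofReal r < 1 := ENNReal.ofReal_lt_one.2 hr.2
  refine brunnMinkowski_real (measurableSet_lt measurable_const hf)
    (measurableSet_lt measurable_const hg) (hf0 _ hr1) (hg0 _ hr1) hs ht ?_
  intro a ha b hb
  refine lt_of_lt_of_le ?_ (hfgh a b)
  calc ENNReal.ofReal r = ENNReal.ofReal r ^ s * ENNReal.ofReal r ^ t := by
        rw [← ENNReal.rpow_add _ _ (by simpa using hr.1) (by simp), hst, ENNReal.rpow_one]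
    _ < _ := ENNReal.mul_lt_mul (ENNReal.rpow_lt_rpow ha hs) (ENNReal.rpow_lt_rpow hb ht)

/-- Divide f and g by their suprema S and T, and h by S^s T^t. -/
theorem prekopaLeindler_real_bounded {s t : ℝ} (hs : 0 < s) (ht : 0 < t) (hst : s + t = 1)
    {f g h : ℝ → ℝ≥0∞} (hf : Measurable f) (hg : Measurable g) (hh : Measurable h)
    {M : ℝ≥0∞} (hM : M ≠ ∞) (hfM : ∀ x, f x ≤ M) (hgM : ∀ x, g x ≤ M)
    (hfgh : ∀ x y, f x ^ s * g y ^ t ≤ h (s * x + t * y)) :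
    (∫⁻ x, f x) ^ s * (∫⁻ x, g x) ^ t ≤ ∫⁻ x, h x := by
  set S := ⨆ x, f x
  set T := ⨆ x, g x
  have hS : S ≠ ∞ := ne_top_of_le_ne_top hM (iSup_le hfM)
  have hT : T ≠ ∞ := ne_top_of_le_ne_top hM (iSup_le hgM)
  rcases eq_or_ne S 0 with hS0 | hS0
  · have : ∀ x, f x = 0 := by simpa [S] using hS0
    simp [this, hs]
  rcases eq_or_ne T 0 with hT0 | hT0
  · have : ∀ x, g x = 0 := by simpa [T] using hT0
    simp [this, ht]
  have hnorm : ∀ (φ : ℝ → ℝ≥0∞) (U : ℝ≥0∞), U = ⨆ x, φ x → U ≠ 0 → U ≠ ∞ →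
      (∀ x, φ x * U⁻¹ ≤ 1) ∧ ∀ r < 1, ∃ x, r < φ x * U⁻¹ := by
    intro φ U hU hU0 hUt
    constructor
    · intro x
      rw [← div_eq_mul_inv]
      refine ENNReal.div_le_of_le_mul ?_
      rw [one_mul, hU]
      exact le_iSup φ x
    · intro r hr
      have : r * U < U := by
        simpa using ENNReal.mul_lt_mul_left hU0 hUt hr
      conv_rhs at this => rw [hU]
      obtain ⟨x, hx⟩ := lt_iSup_iff.1 this
      refine ⟨x, ?_⟩
      rw [← div_eq_mul_inv]
      exact (ENNReal.lt_div_iff_mul_lt (Or.inl hU0) (Or.inl hUt)).2 hx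
  obtain ⟨f1, f2⟩ := hnorm f S rfl hS0 hS
  obtain ⟨g1, g2⟩ := hnorm g T rfl hT0 hT
  have key := prekopaLeindler_real_normalized hs ht hst (hf.mul_const S⁻¹) (hg.mul_const T⁻¹)
    (hh.mul_const (S⁻¹ ^ s * T⁻¹ ^ t)) f1 g1 f2 g2 (fun x y ↦ by
      rw [ENNReal.mul_rpow_of_nonneg _ _ hs.le, ENNReal.mul_rpow_of_nonneg _ _ ht.le,
        mul_mul_mul_comm]
      gcongr
      exact hfgh x y)
  rw [lintegral_mul_const _ hf, lintegral_mul_const _ hg, lintegral_mul_const _ hh,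
    ENNReal.mul_rpow_of_nonneg _ _ hs.le, ENNReal.mul_rpow_of_nonneg _ _ ht.le,
    mul_mul_mul_comm] at key
  refine (ENNReal.mul_le_mul_iff_left (c := S⁻¹ ^ s * T⁻¹ ^ t) ?_ ?_).1 key
  · simp [hS, hT, hs, ht, ENNReal.rpow_eq_zero_iff, hs.le, ht.le, not_lt]
  · exact ENNReal.mul_ne_top (ENNReal.rpow_ne_top_of_nonneg hs.le (by simpa))
      (ENNReal.rpow_ne_top_of_nonneg ht.le (by simpa))

theorem prekopaLeindler_real {s t : ℝ} (hs : 0 < s) (ht : 0 < t) (hst : s + t = 1)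
    {f g h : ℝ → ℝ≥0∞} (hf : Measurable f) (hg : Measurable g) (hh : Measurable h)
    (hfgh : ∀ x y, f x ^ s * g y ^ t ≤ h (s * x + t * y)) :
    (∫⁻ x, f x) ^ s * (∫⁻ x, g x) ^ t ≤ ∫⁻ x, h x := by
  have hsup : ∀ φ : ℝ → ℝ≥0∞, Measurable φ → ∀ r : ℝ, 0 < r →
      (∫⁻ x, φ x) ^ r = ⨆ n : ℕ, (∫⁻ x, min (φ x) n) ^ r := by
    intro φ hφ r hr
    have h1 : ∀ x, φ x = ⨆ n : ℕ, min (φ x) n := fun x ↦ by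
      have : φ x ⊓ ⨆ n : ℕ, (n : ℝ≥0∞) = ⨆ n : ℕ, φ x ⊓ n := inf_iSup_eq ..
      rw [ENNReal.iSup_natCast, inf_top_eq] at this
      exact this
    have h2 : ∫⁻ x, φ x = ⨆ n : ℕ, ∫⁻ x, min (φ x) n := by
      rw [← lintegral_iSup (fun n ↦ hφ.min measurable_const)]
      · exact lintegral_congr h1
      · intro n m hnm x
        dsimp only
        gcongr
    rw [h2]
    exact (ENNReal.orderIsoRpow r hr).map_iSup _
  rw [hsup f hf s hs, hsup g hg t ht, ENNReal.iSup_mul]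
  refine iSup_le fun n ↦ ?_
  rw [ENNReal.mul_iSup]
  refine iSup_le fun m ↦ ?_
  refine prekopaLeindler_real_bounded hs ht hst (hf.min measurable_const) (hg.min measurable_const)
    hh (M := (max n m : ℕ)) (ENNReal.natCast_ne_top _) (fun x ↦ ?_) (fun x ↦ ?_) (fun x y ↦ ?_)
  · exact (min_le_right _ _).trans (by exact_mod_cast le_max_left n m)
  · exact (min_le_right _ _).trans (by exact_mod_cast le_max_right n m)
  · refine le_trans ?_ (hfgh x y)
    gcongr <;> exact min_le_left _ _

theorem measurable_fin_cons {n : ℕ} :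
    Measurable fun p : ℝ × (Fin n → ℝ) ↦ (Fin.cons p.1 p.2 : Fin (n + 1) → ℝ) := by
  refine measurable_pi_iff.2 fun i ↦ Fin.cases ?_ (fun j ↦ ?_) i
  · simpa using measurable_fst
  · simp only [Fin.cons_succ]
    fun_prop

theorem lintegral_fin_succ {n : ℕ} {f : (Fin (n + 1) → ℝ) → ℝ≥0∞} (hf : Measurable f) :
    ∫⁻ x, f x = ∫⁻ a : ℝ, ∫⁻ y : Fin n → ℝ, f (Fin.cons a y) := by
  have hmp := (volume_preserving_piFinSuccAbove (fun _ : Fin (n + 1) ↦ ℝ) 0).symm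
  have hcons : ∀ p : ℝ × (Fin n → ℝ),
      (MeasurableEquiv.piFinSuccAbove (fun _ : Fin (n + 1) ↦ ℝ) 0).symm p = Fin.cons p.1 p.2 := by
    intro p
    simp only [MeasurableEquiv.piFinSuccAbove]
    simp
    rfl
  rw [← hmp.lintegral_comp hf, volume_eq_prod]
  simp only [hcons]
  exact lintegral_prod (fun p : ℝ × (Fin n → ℝ) ↦ f (Fin.cons p.1 p.2))
    (hf.comp measurable_fin_cons).aemeasurable

/-- Induction on the dimension: by the inductive hypothesis on fibres, the integrals over the last n
coordinates satisfy the one-dimensional hypothesis. -/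
theorem prekopaLeindler {s t : ℝ} (hs : 0 < s) (ht : 0 < t) (hst : s + t = 1) (n : ℕ)
    {f g h : (Fin n → ℝ) → ℝ≥0∞} (hf : Measurable f) (hg : Measurable g) (hh : Measurable h)
    (hfgh : ∀ x y, f x ^ s * g y ^ t ≤ h (s • x + t • y)) :
    (∫⁻ x, f x) ^ s * (∫⁻ x, g x) ^ t ≤ ∫⁻ x, h x := by
  induction n with
  | zero =>
    rw [volume_pi_eq_dirac 0, lintegral_dirac, lintegral_dirac, lintegral_dirac]
    refine (hfgh 0 0).trans (le_of_eq ?_)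
    congr 1
    exact Subsingleton.elim _ _
  | succ n ih =>
    rw [lintegral_fin_succ hf, lintegral_fin_succ hg, lintegral_fin_succ hh]
    have hcons : ∀ (φ : (Fin (n + 1) → ℝ) → ℝ≥0∞), Measurable φ → ∀ a,
        Measurable fun y : Fin n → ℝ ↦ φ (Fin.cons a y) := fun φ hφ a ↦
      (hφ.comp measurable_fin_cons).comp measurable_prodMk_left
    refine prekopaLeindler_real hs ht hst
      (hf.comp measurable_fin_cons).lintegral_prod_right'
      (hg.comp measurable_fin_cons).lintegral_prod_right'
      (hh.comp measurable_fin_cons).lintegral_prod_right' fun a b ↦ ?_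
    refine ih (hcons f hf a) (hcons g hg b) (hcons h hh _) fun x y ↦ ?_
    refine (hfgh _ _).trans (le_of_eq ?_)
    congr 1
    ext i
    refine Fin.cases ?_ (fun j ↦ ?_) i <;> simp

theorem brunnMinkowski_multiplicative {s t : ℝ} (hs : 0 < s) (ht : 0 < t) (hst : s + t = 1)
    {d : ℕ} {A B C : Set (EuclideanSpace ℝ (Fin d))} (hA : MeasurableSet A) (hB : MeasurableSet B)
    (hC : MeasurableSet C) (h : ∀ a ∈ A, ∀ b ∈ B, s • a + t • b ∈ C) :
    volume A ^ s * volume B ^ t ≤ volume C := by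
  have hintegral : ∀ D : Set (EuclideanSpace ℝ (Fin d)), MeasurableSet D →
      MeasurableSet (WithLp.toLp 2 ⁻¹' D) ∧
      volume D = ∫⁻ x : Fin d → ℝ, (WithLp.toLp 2 ⁻¹' D).indicator 1 x := by
    intro D hD
    have hm : MeasurableSet (WithLp.toLp 2 ⁻¹' D : Set (Fin d → ℝ)) :=
      (PiLp.volume_preserving_toLp (Fin d)).measurable hD
    refine ⟨hm, ?_⟩
    rw [lintegral_indicator_one hm,
      (PiLp.volume_preserving_toLp (Fin d)).measure_preimage hD.nullMeasurableSet]
  obtain ⟨mA, eA⟩ := hintegral A hA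
  obtain ⟨mB, eB⟩ := hintegral B hB
  obtain ⟨mC, eC⟩ := hintegral C hC
  rw [eA, eB, eC]
  refine prekopaLeindler hs ht hst d (measurable_one.indicator mA) (measurable_one.indicator mB)
    (measurable_one.indicator mC) fun x y ↦ ?_
  by_cases hx : x ∈ WithLp.toLp 2 ⁻¹' A
  · by_cases hy : y ∈ WithLp.toLp 2 ⁻¹' B
    · have : s • x + t • y ∈ WithLp.toLp 2 ⁻¹' C := by
        have := h _ hx _ hy
        rwa [← WithLp.toLp_smul, ← WithLp.toLp_smul, ← WithLp.toLp_add] at this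
      simp [indicator_of_mem hx, indicator_of_mem hy, indicator_of_mem this]
    · simp [indicator_of_notMem hy, ht]
  · simp [indicator_of_notMem hx, hs]

/-- The Brunn–Minkowski inequality for sets of volume `α ^ d` and `β ^ d`. -/
theorem brunnMinkowski {d : ℕ} {A B : Set (EuclideanSpace ℝ (Fin d))} (hA : IsOpen A)
    (hB : IsOpen B) {α β : ℝ} (hα : 0 < α) (hβ : 0 < β)
    (hvA : volume A = ENNReal.ofReal (α ^ d)) (hvB : volume B = ENNReal.ofReal (β ^ d)) :
    ENNReal.ofReal ((α + β) ^ d) ≤ volume (A + B) := by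
  have hnorm : ∀ {D : Set (EuclideanSpace ℝ (Fin d))} {γ : ℝ}, 0 < γ →
      volume D = ENNReal.ofReal (γ ^ d) → volume (γ⁻¹ • D) = 1 := by
    intro D γ hγ hD
    rw [addHaar_smul_of_nonneg _ (inv_nonneg.2 hγ.le), hD, finrank_euclideanSpace_fin,
      ← ENNReal.ofReal_mul (by positivity), ← mul_pow, inv_mul_cancel₀ hγ.ne', one_pow,
      ENNReal.ofReal_one]
  have hab : 0 < α + β := by positivity
  -- Rescaled to volume 1, `A` and `B` have (A + B)/(α + β) as their combination with these weights,
  -- so the multiplicative form becomes the additive one.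
  have key := brunnMinkowski_multiplicative (s := α / (α + β)) (t := β / (α + β))
    (by positivity) (by positivity) (by field_simp) (A := α⁻¹ • A) (B := β⁻¹ • B)
    (C := (α + β)⁻¹ • (A + B)) (hA.smul₀ (inv_ne_zero hα.ne')).measurableSet
    (hB.smul₀ (inv_ne_zero hβ.ne')).measurableSet
    (hA.add_right.smul₀ (inv_ne_zero hab.ne')).measurableSet (by
      rintro _ ⟨a, ha, rfl⟩ _ ⟨b, hb, rfl⟩
      refine ⟨a + b, add_mem_add ha hb, ?_⟩
      simp only [smul_smul, smul_add]
      congr 2 <;> field_simp)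
  rw [hnorm hα hvA, hnorm hβ hvB, ENNReal.one_rpow, ENNReal.one_rpow, one_mul,
    addHaar_smul_of_nonneg _ (inv_nonneg.2 hab.le), finrank_euclideanSpace_fin] at key
  calc _ = ENNReal.ofReal ((α + β) ^ d) * 1 := (mul_one _).symm
    _ ≤ ENNReal.ofReal ((α + β) ^ d) * (ENNReal.ofReal ((α + β)⁻¹ ^ d) * volume (A + B)) := by
      gcongr
    _ = _ := by
      rw [← mul_assoc, ← ENNReal.ofReal_mul (by positivity), ← mul_pow, mul_inv_cancel₀ hab.ne',
        one_pow, ENNReal.ofReal_one, one_mul]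

end

section

/-! ### The isoperimetric inequality for sublevel sets of gauges -/

theorem pow_add_mul_le_add_pow {x y : ℝ} (hx : 0 ≤ x) (hy : 0 ≤ y) (n : ℕ) :
    x ^ (n + 1) + (n + 1) * x ^ n * y ≤ (x + y) ^ (n + 1) := by
  induction n with
  | zero => simp
  | succ n ih =>
    have h : (0 : ℝ) ≤ (n + 1) * x ^ n * y * y := by positivity
    calc _ ≤ (x ^ (n + 1) + (n + 1) * x ^ n * y) * (x + y) := by
          push_cast
          ring_nf at h ⊢
          linarith
      _ ≤ (x + y) ^ (n + 1) * (x + y) := by gcongr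
      _ = _ := by ring

/-- The part below `g x` and in the unit interval of the half-line above `inf g` over the
`ε`-ball centered at `x`. -/
def verticalGap {V : Type*} [NormedAddCommGroup V] (g : V → ℝ) (ε : ℝ) : Set (V × ℝ) :=
  {p | p.2 ∈ Ioo 0 1 ∧ p.2 ≤ g p.1 ∧ ∃ b ∈ ball (0 : V) ε, g (p.1 - b) < p.2}

theorem volume_slice_le {V : Type*} [NormedAddCommGroup V] {g : V → ℝ} {ε m : ℝ} {x : V}
    (h : ∀ b ∈ ball (0 : V) ε, g x - m ≤ g (x - b)) :
    volume {t | (x, t) ∈ verticalGap g ε} ≤ ENNReal.ofReal m := by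
  calc _ ≤ volume (Ioc (g x - m) (g x)) := by
        refine measure_mono ?_
        rintro t ⟨-, h1, b, hb, h2⟩
        exact ⟨(h b hb).trans_lt h2, h1⟩
    _ = _ := by rw [Real.volume_Ioc]; congr 1; ring

/-- To first order, g drops by at most ε‖∇g(x)‖ on the ε-ball around x. -/
theorem eventually_volume_slice_le {V : Type*} [NormedAddCommGroup V] [NormedSpace ℝ V]
    {g : V → ℝ} {x : V} (hx : DifferentiableAt ℝ g x) {τ : ℝ} (hτ : 0 < τ) :
    ∀ᶠ ε in 𝓝[>] (0 : ℝ), volume {t | (x, t) ∈ verticalGap g ε} ≤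
      ENNReal.ofReal (ε * (‖fderiv ℝ g x‖ + τ)) := by
  have h1 := hx.hasFDerivAt.isLittleO.def hτ
  obtain ⟨r, hr, hball⟩ := Metric.eventually_nhds_iff.1 h1
  filter_upwards [Ioo_mem_nhdsGT hr] with ε hε
  refine volume_slice_le fun b hb ↦ ?_
  have hb' : ‖b‖ < ε := by simpa using hb
  have h2 := @hball (x - b) (by
    rw [dist_eq_norm, sub_sub_cancel_left, norm_neg]; exact hb'.trans hε.2)
  rw [sub_sub_cancel_left, norm_neg, Real.norm_eq_abs, map_neg] at h2
  have h3 := (fderiv ℝ g x).le_opNorm b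
  rw [Real.norm_eq_abs] at h3
  have h4 : ‖fderiv ℝ g x‖ * ‖b‖ ≤ ‖fderiv ℝ g x‖ * ε := by gcongr
  have h5 : τ * ‖b‖ ≤ τ * ε := by gcongr
  linarith [(abs_le.1 h2).1, (abs_le.1 h3).2]

namespace IsGauge

section General

variable {V : Type*} [NormedAddCommGroup V] [InnerProductSpace ℝ V]
variable {g : V → ℝ} {c : ℝ} {L : ℝ≥0} (hg : IsGauge g c L)
include hg

theorem sublevel_eq_smul {t : ℝ} (ht : 0 < t) : {x | g x < t} = t • {x | g x < 1} := by
  ext x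
  rw [mem_smul_set_iff_inv_smul_mem₀ ht.ne']
  simp only [mem_ofPred_eq, hg.map_smul _ (inv_pos.2 ht)]
  rw [inv_mul_lt_one₀ ht]

theorem sublevel_subset_ball (t : ℝ) : {x | g x < t} ⊆ ball 0 (t / c) := by
  intro x hx
  rw [mem_ball_zero_iff, lt_div_iff₀ hg.pos]
  have := hg.le x
  have hx' : g x < t := hx
  linarith

theorem isOpen_sublevel (t : ℝ) : IsOpen {x | g x < t} :=
  isOpen_lt hg.continuous continuous_const

theorem norm_fderiv_le (x : V) : ‖fderiv ℝ g x‖ ≤ L :=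
  norm_fderiv_le_of_lipschitz ℝ hg.lipschitz

variable [FiniteDimensional ℝ V] [MeasurableSpace V] [BorelSpace V]

theorem volume_sublevel_lt_top (t : ℝ) : volume {x | g x < t} < ∞ :=
  (measure_mono (hg.sublevel_subset_ball t)).trans_lt measure_ball_lt_top

theorem volume_sublevel_pos {t : ℝ} (ht : 0 < t) : 0 < volume {x | g x < t} :=
  (hg.isOpen_sublevel t).measure_pos volume ⟨0, by simpa [hg.map_zero] using ht⟩

theorem lintegral_enorm_fderiv_lt_top : ∫⁻ z in {z | g z < 1}, ‖fderiv ℝ g z‖ₑ < ∞ := by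
  calc _ ≤ ∫⁻ z in {z | g z < 1}, (L : ℝ≥0∞) := by
        refine lintegral_mono fun z ↦ ?_
        rw [enorm_le_coe]
        exact hg.norm_fderiv_le z
    _ < ∞ := by
        rw [setLIntegral_const]
        exact ENNReal.mul_lt_top (by simp) (hg.volume_sublevel_lt_top 1)

theorem area_level_set_lt_top [Nontrivial V] : μHE[finrank ℝ V - 1] {x | g x = 1} < ∞ := by
  rw [hg.area_level_set]
  exact ENNReal.mul_lt_top (by simp) hg.lintegral_enorm_fderiv_lt_top

/-- A set of finite (d−1)-dimensional measure is null in dimension d. -/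
theorem volume_level_set [Nontrivial V] : volume {x | g x = 1} = 0 := by
  have hd : 0 < finrank ℝ V := finrank_pos
  have := euclideanHausdorffMeasure_zero_or_top (Nat.sub_lt hd one_pos) {x | g x = 1}
  rw [InnerProductSpace.euclideanHausdorffMeasure_eq_volume] at this
  exact this.resolve_right hg.area_level_set_lt_top.ne

omit [FiniteDimensional ℝ V] in
theorem measurableSet_verticalGap (ε : ℝ) : MeasurableSet (verticalGap g ε) := by
  have hgc := hg.continuous
  refine (measurable_snd measurableSet_Ioo).inter
    ((measurableSet_le measurable_snd (hgc.measurable.comp measurable_fst)).inter ?_)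
  have : {p : V × ℝ | ∃ b ∈ ball (0 : V) ε, g (p.1 - b) < p.2} =
      ⋃ b ∈ ball (0 : V) ε, {p : V × ℝ | g (p.1 - b) < p.2} := by
    ext p; simp
  refine IsOpen.measurableSet ?_
  change IsOpen {p : V × ℝ | ∃ b ∈ ball (0 : V) ε, g (p.1 - b) < p.2}
  rw [this]
  exact isOpen_biUnion fun b _ ↦ isOpen_lt (by fun_prop) (by fun_prop)

omit [FiniteDimensional ℝ V] [MeasurableSpace V] [BorelSpace V] in
theorem sub_le_of_mem_ball {ε : ℝ} {x b : V} (hb : b ∈ ball (0 : V) ε) :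
    g x - L * ε ≤ g (x - b) := by
  have h1 := hg.abs_sub_le x (x - b)
  rw [sub_sub_cancel] at h1
  have h2 : ‖b‖ < ε := by simpa using hb
  have h3 : (L : ℝ) * ‖b‖ ≤ L * ε := by gcongr
  linarith [(abs_le.1 h1).2]

omit [FiniteDimensional ℝ V] [MeasurableSpace V] [BorelSpace V] in
theorem volume_slice_eq_zero {ε : ℝ} {x : V} (hx : 1 + L * ε ≤ g x) :
    volume {t | (x, t) ∈ verticalGap g ε} = 0 := by
  convert measure_empty (μ := (volume : Measure ℝ))
  ext t
  simp only [mem_empty_iff_false, iff_false]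
  rintro ⟨⟨-, h0⟩, -, b, hb, h2⟩
  have := hg.sub_le_of_mem_ball hb (x := x)
  have h0' : t < 1 := h0
  have h2' : g (x - b) < t := h2
  linarith

end General

section Euclidean

variable {d : ℕ} {g : EuclideanSpace ℝ (Fin d) → ℝ} {c : ℝ} {L : ℝ≥0} (hg : IsGauge g c L)
include hg

theorem volume_sublevel_eq {α t : ℝ} (ht : 0 < t)
    (hvol : volume {x | g x < 1} = ENNReal.ofReal (α ^ d)) :
    volume {x | g x < t} = ENNReal.ofReal ((t * α) ^ d) := by
  rw [hg.sublevel_eq_smul ht, addHaar_smul_of_nonneg _ ht.le, hvol, finrank_euclideanSpace_fin,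
    ← ENNReal.ofReal_mul (by positivity), mul_pow]

/-- Brunn–Minkowski gives the thickened set volume at least (tα + εβ)^d; keep the first two binomial
terms. -/
theorem le_volume_thickening_diff {α β t ε : ℝ} (hα : 0 < α) (hβ : 0 < β) (ht : 0 < t)
    (hε : 0 < ε) (hd : 0 < d) (hvol : volume {x | g x < 1} = ENNReal.ofReal (α ^ d))
    (hball : volume (ball (0 : EuclideanSpace ℝ (Fin d)) 1) = ENNReal.ofReal (β ^ d)) :
    ENNReal.ofReal (d * (t * α) ^ (d - 1) * (ε * β)) ≤
      volume (({x | g x < t} + ball (0 : EuclideanSpace ℝ (Fin d)) ε) \ {x | g x < t}) := by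
  have hB : volume (ball (0 : EuclideanSpace ℝ (Fin d)) ε) = ENNReal.ofReal ((ε * β) ^ d) := by
    rw [addHaar_ball_of_pos _ _ hε, hball, finrank_euclideanSpace_fin,
      ← ENNReal.ofReal_mul (by positivity), mul_pow]
  have hA := hg.volume_sublevel_eq ht hvol
  have hBM := brunnMinkowski (hg.isOpen_sublevel t) isOpen_ball (by positivity) (by positivity)
    hA hB
  refine le_trans ?_ (le_measure_sdiff)
  rw [hA]
  refine le_trans ?_ (tsub_le_tsub_right hBM _)
  rw [← ENNReal.ofReal_sub _ (by positivity)]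
  refine ENNReal.ofReal_le_ofReal ?_
  obtain ⟨n, rfl⟩ : ∃ n, d = n + 1 := ⟨d - 1, by omega⟩
  have := pow_add_mul_le_add_pow (x := t * α) (y := ε * β) (by positivity) (by positivity) n
  push_cast
  linarith

/-- Integrate over t first: the slice of the gap at height t contains the ε-shell around {g < t},
and ∫₀¹ d t^(d-1) dt = 1. -/
theorem le_lintegral_slice {α β ε : ℝ} (hα : 0 < α) (hβ : 0 < β)
    (hε : 0 < ε) (hd : 0 < d) (hvol : volume {x | g x < 1} = ENNReal.ofReal (α ^ d))
    (hball : volume (ball (0 : EuclideanSpace ℝ (Fin d)) 1) = ENNReal.ofReal (β ^ d)) :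
    ENNReal.ofReal (ε * (α ^ (d - 1) * β)) ≤
      ∫⁻ x, volume {t | (x, t) ∈ verticalGap g ε} := by
  have hm := hg.measurableSet_verticalGap ε
  have h1 : ∫⁻ x, volume {t | (x, t) ∈ verticalGap g ε} =
      ∫⁻ t, volume {x | (x, t) ∈ verticalGap g ε} :=
    (Measure.prod_apply hm).symm.trans (Measure.prod_apply_symm hm)
  rw [h1]
  calc ENNReal.ofReal (ε * (α ^ (d - 1) * β))
      = ∫⁻ t in Ioo (0 : ℝ) 1, ENNReal.ofReal (d * (t * α) ^ (d - 1) * (ε * β)) := by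
        rw [← ofReal_integral_eq_lintegral_ofReal]
        · congr 1
          rw [← integral_Ioc_eq_integral_Ioo, ← intervalIntegral.integral_of_le zero_le_one]
          have : ∀ t : ℝ, d * (t * α) ^ (d - 1) * (ε * β) =
              (d * α ^ (d - 1) * (ε * β)) * t ^ (d - 1) := fun t ↦ by rw [mul_pow]; ring
          simp only [this]
          rw [intervalIntegral.integral_const_mul, integral_pow, Nat.sub_add_cancel hd,
            Nat.cast_pred hd, one_pow, zero_pow hd.ne']
          have : (d : ℝ) ≠ 0 := by exact_mod_cast hd.ne'
          field_simp
          simp [this]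
        · exact (Continuous.integrableOn_Icc (by fun_prop)).mono_set Ioo_subset_Icc_self
        · filter_upwards [ae_restrict_mem measurableSet_Ioo] with t ht
          have := ht.1
          positivity
    _ ≤ ∫⁻ t in Ioo (0 : ℝ) 1, volume {x | (x, t) ∈ verticalGap g ε} := by
        refine setLIntegral_mono' measurableSet_Ioo fun t ht ↦ ?_
        refine (hg.le_volume_thickening_diff hα hβ ht.1 hε hd hvol hball).trans
          (measure_mono ?_)
        rintro _ ⟨⟨a, ha, b, hb, rfl⟩, h2⟩
        refine ⟨ht, not_lt.1 h2, b, hb, ?_⟩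
        simpa using ha
    _ ≤ _ := setLIntegral_le_lintegral _ _

/-- The isoperimetric inequality, in terms of the volumes `α ^ d` of `{g < 1}` and `β ^ d` of the
unit ball. -/
theorem isoperimetric {α β : ℝ} (hα : 0 < α) (hβ : 0 < β)
    (hd : 0 < d) (hvol : volume {x | g x < 1} = ENNReal.ofReal (α ^ d))
    (hball : volume (ball (0 : EuclideanSpace ℝ (Fin d)) 1) = ENNReal.ofReal (β ^ d)) :
    ENNReal.ofReal (α ^ (d - 1) * β) ≤ ∫⁻ z in {z | g z < 1}, ‖fderiv ℝ g z‖ₑ := by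
  have : Nontrivial (EuclideanSpace ℝ (Fin d)) := by
    rw [← Module.finrank_pos_iff (R := ℝ), finrank_euclideanSpace_fin]; exact hd
  set ε : ℕ → ℝ := fun n ↦ 1 / ((n : ℝ) + 1)
  have hε : ∀ n, 0 < ε n := fun n ↦ by positivity
  have hε1 : ∀ n, ε n ≤ 1 := fun n ↦ by
    simp only [ε]; rw [div_le_one (by positivity)]; linarith [n.cast_nonneg (α := ℝ)]
  have hεlim : Tendsto ε atTop (𝓝[>] 0) :=
    tendsto_nhdsWithin_iff.2 ⟨tendsto_one_div_add_atTop_nhds_zero_nat,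
      Eventually.of_forall hε⟩
  -- Gap lengths divided by ε. Their integrals all exceed the target, while almost everywhere their
  -- limsup is at most |∇g| on {g < 1} and 0 outside; reverse Fatou, with dominating function L on
  -- {g < 1 + L}, concludes.
  set D : ℕ → EuclideanSpace ℝ (Fin d) → ℝ≥0∞ := fun n x ↦
    ENNReal.ofReal (ε n)⁻¹ * volume {t | (x, t) ∈ verticalGap g (ε n)} with hD
  have hscale : ∀ n r, ENNReal.ofReal (ε n)⁻¹ * ENNReal.ofReal (ε n * r) = ENNReal.ofReal r := by
    intro n r
    rw [← ENNReal.ofReal_mul (inv_nonneg.2 (hε n).le), inv_mul_cancel_left₀ (hε n).ne']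
  have hDm : ∀ n, Measurable (D n) := fun n ↦
    (measurable_measure_prodMk_left (hg.measurableSet_verticalGap (ε n))).const_mul _
  have hlow : ∀ n, ENNReal.ofReal (α ^ (d - 1) * β) ≤ ∫⁻ x, D n x := by
    intro n
    have h1 : ∫⁻ x, D n x = ENNReal.ofReal (ε n)⁻¹ *
        ∫⁻ x, volume {t | (x, t) ∈ verticalGap g (ε n)} :=
      lintegral_const_mul _ (measurable_measure_prodMk_left (hg.measurableSet_verticalGap (ε n)))
    rw [h1, ← hscale n]
    gcongr
    exact hg.le_lintegral_slice hα hβ (hε n) hd hvol hball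
  have hbound : ∀ n x, D n x ≤ {x | g x < 1 + L}.indicator (fun _ ↦ (L : ℝ≥0∞)) x := by
    intro n x
    by_cases hx : g x < 1 + L
    · rw [indicator_of_mem (by exact hx)]
      calc D n x ≤ ENNReal.ofReal (ε n)⁻¹ * ENNReal.ofReal (ε n * L) := by
            simp only [hD]
            gcongr
            exact volume_slice_le fun b hb ↦ by
              have := hg.sub_le_of_mem_ball hb (x := x); linarith
        _ = L := by rw [hscale]; simp
    · have : volume {t | (x, t) ∈ verticalGap g (ε n)} = 0 := by
        refine hg.volume_slice_eq_zero ?_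
        have : (L : ℝ) * ε n ≤ L * 1 := by gcongr; exact hε1 n
        linarith
      simp [hD, this]
  have hlimsup : ∀ᵐ x, limsup (fun n ↦ D n x) atTop ≤
      {x | g x < 1}.indicator (fun x ↦ ‖fderiv ℝ g x‖ₑ) x := by
    filter_upwards [hg.lipschitz.ae_differentiableAt,
      measure_eq_zero_iff_ae_notMem.1 hg.volume_level_set] with x hx hx1
    rcases lt_or_gt_of_ne (show g x ≠ 1 from hx1) with h | h
    · rw [indicator_of_mem (by exact h), ← ofReal_norm]
      refine le_of_forall_gt_imp_ge_of_dense fun y hy ↦ ?_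
      rcases eq_or_ne y ∞ with rfl | hytop
      · exact le_top
      have hy' : ‖fderiv ℝ g x‖ < y.toReal :=
        (ENNReal.ofReal_lt_iff_lt_toReal (norm_nonneg _) hytop).1 hy
      refine limsup_le_of_le (by isBoundedDefault) ?_
      filter_upwards [hεlim.eventually (eventually_volume_slice_le hx (sub_pos.2 hy'))] with n hn
      calc D n x ≤ ENNReal.ofReal (ε n)⁻¹ * ENNReal.ofReal
            (ε n * (‖fderiv ℝ g x‖ + (y.toReal - ‖fderiv ℝ g x‖))) := by
            simp only [hD]; gcongr
        _ = y := by rw [hscale, add_sub_cancel, ENNReal.ofReal_toReal hytop]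
    · refine limsup_le_of_le (by isBoundedDefault) ?_
      have h0 : Tendsto (fun n ↦ 1 + L * ε n) atTop (𝓝 (1 + L * 0)) :=
        ((hεlim.mono_right nhdsWithin_le_nhds).const_mul _).const_add _
      rw [mul_zero, add_zero] at h0
      filter_upwards [h0.eventually (gt_mem_nhds h)] with n hn
      simp [hD, hg.volume_slice_eq_zero hn.le]
  calc ENNReal.ofReal (α ^ (d - 1) * β) ≤ limsup (fun n ↦ ∫⁻ x, D n x) atTop :=
        le_limsup_of_frequently_le (Frequently.of_forall hlow) (by isBoundedDefault)
    _ ≤ ∫⁻ x, limsup (fun n ↦ D n x) atTop := by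
        refine limsup_lintegral_le _ hDm (fun n ↦ Eventually.of_forall (hbound n)) ?_
        rw [lintegral_indicator (hg.isOpen_sublevel _).measurableSet, setLIntegral_const]
        exact (ENNReal.mul_lt_top (by simp) (hg.volume_sublevel_lt_top _)).ne
    _ ≤ ∫⁻ x, {x | g x < 1}.indicator (fun x ↦ ‖fderiv ℝ g x‖ₑ) x := lintegral_mono_ae hlimsup
    _ = _ := lintegral_indicator (hg.isOpen_sublevel _).measurableSet _

end Euclidean

end IsGauge

end

section

/-! ### The gauge of a starlike domain -/

section Gauge

variable {d : ℕ} {R : USphere d → ℝ}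

/-- The unit vector in the direction of a nonzero vector. -/
noncomputable def direction {x : EuclideanSpace ℝ (Fin d)} (hx : x ≠ 0) : USphere d :=
  ⟨‖x‖⁻¹ • x, by
    rw [mem_sphere_zero_iff_norm, norm_smul, norm_inv, norm_norm,
      inv_mul_cancel₀ (norm_ne_zero_iff.mpr hx)]⟩

theorem homExt_of_ne {x : EuclideanSpace ℝ (Fin d)} (hx : x ≠ 0) :
    homExt R x = R (direction hx) := dif_pos hx

theorem coe_ne_zero (ξ : USphere d) : (ξ : EuclideanSpace ℝ (Fin d)) ≠ 0 :=
  ne_zero_of_mem_unit_sphere ξ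

theorem homExt_coe (ξ : USphere d) : homExt R ξ = R ξ := by
  rw [homExt_of_ne (coe_ne_zero ξ)]
  congr 1
  ext1
  simp [direction]

theorem homExt_smul {t : ℝ} (ht : 0 < t) (x : EuclideanSpace ℝ (Fin d)) :
    homExt R (t • x) = homExt R x := by
  by_cases hx : x = 0
  · simp [hx]
  · rw [homExt_of_ne hx, homExt_of_ne (smul_ne_zero ht.ne' hx)]
    congr 1
    ext1
    simp only [direction, norm_smul, smul_smul, Real.norm_of_nonneg ht.le]
    congr 1
    field_simp

/-- The gauge function of the starlike domain with radius function `R`. -/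
noncomputable def radialGauge (R : USphere d → ℝ) (x : EuclideanSpace ℝ (Fin d)) : ℝ :=
  ‖x‖ / homExt R x

theorem radialGauge_coe (ξ : USphere d) : radialGauge R ξ = (R ξ)⁻¹ := by
  rw [radialGauge, homExt_coe, norm_eq_of_mem_sphere, one_div]

theorem radialGauge_smul {t : ℝ} (ht : 0 < t) (x : EuclideanSpace ℝ (Fin d)) :
    radialGauge R (t • x) = t * radialGauge R x := by
  rw [radialGauge, radialGauge, homExt_smul ht, norm_smul, Real.norm_of_nonneg ht.le, mul_div_assoc]

theorem exists_bounds (hpos : ∀ ξ, 0 < R ξ) (hR : Continuous R) :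
    ∃ m M : ℝ, 0 < m ∧ 0 < M ∧ ∀ ξ, m ≤ R ξ ∧ R ξ ≤ M := by
  rcases isEmpty_or_nonempty (USphere d) with h | h
  · exact ⟨1, 1, one_pos, one_pos, fun ξ ↦ (h.false ξ).elim⟩
  · obtain ⟨a, -, ha⟩ := isCompact_univ.exists_isMinOn univ_nonempty hR.continuousOn
    obtain ⟨b, -, hb⟩ := isCompact_univ.exists_isMaxOn univ_nonempty hR.continuousOn
    exact ⟨R a, R b, hpos a, hpos b, fun ξ ↦ ⟨ha (mem_univ ξ), hb (mem_univ ξ)⟩⟩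

theorem norm_mul_dist_direction_le {x y : EuclideanSpace ℝ (Fin d)} (hx : x ≠ 0) (hy : y ≠ 0) :
    ‖y‖ * dist (direction hx) (direction hy) ≤ 2 * ‖x - y‖ := by
  have hx' := norm_pos_iff.2 hx
  have hy' := norm_pos_iff.2 hy
  have e : ‖y‖ • (‖x‖⁻¹ • x - ‖y‖⁻¹ • y) = (x - y) + (‖y‖ - ‖x‖) • ‖x‖⁻¹ • x := by
    rw [sub_smul, smul_inv_smul₀ hx'.ne', smul_sub, smul_inv_smul₀ hy'.ne']
    abel
  have h1 : ‖(‖x‖⁻¹ • x : EuclideanSpace ℝ (Fin d))‖ = 1 := by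
    rw [norm_smul, norm_inv, norm_norm, inv_mul_cancel₀ hx'.ne']
  rw [Subtype.dist_eq, dist_eq_norm]
  calc _ = ‖‖y‖ • (‖x‖⁻¹ • x - ‖y‖⁻¹ • y)‖ := by rw [norm_smul, norm_norm]; rfl
    _ ≤ ‖x - y‖ + ‖(‖y‖ - ‖x‖) • ‖x‖⁻¹ • x‖ := by rw [e]; exact norm_add_le _ _
    _ ≤ ‖x - y‖ + ‖x - y‖ := by
        rw [norm_smul, h1, mul_one, Real.norm_eq_abs, norm_sub_rev x y]
        gcongr
        exact abs_norm_sub_norm_le y x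
    _ = _ := by ring

/-- The homogeneous extension of `R` is not Lipschitz near 0, but its variation enters multiplied by
‖y‖, which compensates by `norm_mul_dist_direction_le`. -/
theorem isGauge_radialGauge (hpos : ∀ ξ, 0 < R ξ) {K : ℝ≥0} (hR : LipschitzWith K R) :
    ∃ c L, IsGauge (radialGauge R) c L := by
  obtain ⟨m, M, hm, hM, hb⟩ := exists_bounds hpos hR.continuous
  have hmain : ∀ {x y : EuclideanSpace ℝ (Fin d)}, x ≠ 0 → y ≠ 0 →
      |radialGauge R x - radialGauge R y| ≤ (m⁻¹ + 2 * K / m ^ 2) * ‖x - y‖ := by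
    intro x y hx hy
    rw [radialGauge, radialGauge, homExt_of_ne hx, homExt_of_ne hy]
    set a := R (direction hx)
    set b := R (direction hy)
    have ha : m ≤ a := (hb _).1
    have hb' : m ≤ b := (hb _).1
    have ha0 : 0 < a := hm.trans_le ha
    have hb0 : 0 < b := hm.trans_le hb'
    have h1 : |b - a| ≤ K * dist (direction hx) (direction hy) := by
      rw [abs_sub_comm]
      exact hR.dist_le_mul (direction hx) (direction hy)
    have e : ‖x‖ / a - ‖y‖ / b = a⁻¹ * (‖x‖ - ‖y‖) + (‖y‖ * (b - a)) / (a * b) := by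
      field_simp; ring
    rw [e]
    calc _ ≤ |a⁻¹ * (‖x‖ - ‖y‖)| + |(‖y‖ * (b - a)) / (a * b)| := abs_add_le _ _
      _ = a⁻¹ * |‖x‖ - ‖y‖| + (‖y‖ * |b - a|) / (a * b) := by
          rw [abs_mul, abs_div, abs_mul, abs_of_pos (inv_pos.2 ha0), abs_of_pos (mul_pos ha0 hb0),
            abs_norm]
      _ ≤ m⁻¹ * ‖x - y‖ + (K * (2 * ‖x - y‖)) / (m * m) := by
          have h2 : ‖y‖ * |b - a| ≤ K * (2 * ‖x - y‖) := by
            calc ‖y‖ * |b - a| ≤ ‖y‖ * (K * dist (direction hx) (direction hy)) := by gcongr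
              _ = K * (‖y‖ * dist (direction hx) (direction hy)) := by ring
              _ ≤ _ := mul_le_mul_of_nonneg_left (norm_mul_dist_direction_le hx hy) K.2
          have h3 := abs_norm_sub_norm_le x y
          gcongr
      _ = _ := by ring
  have hub : ∀ x, |radialGauge R x| ≤ m⁻¹ * ‖x‖ := by
    intro x
    by_cases hx : x = 0
    · simp [hx, radialGauge]
    · rw [radialGauge, homExt_of_ne hx, abs_div, abs_norm, abs_of_pos (hpos _), div_eq_inv_mul]
      gcongr
      exact (hb _).1
  have hL : m⁻¹ ≤ m⁻¹ + 2 * K / m ^ 2 := le_add_of_nonneg_right (by positivity)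
  refine ⟨M⁻¹, (m⁻¹ + 2 * K / m ^ 2).toNNReal, ?_, fun t ht x ↦ radialGauge_smul ht x,
    inv_pos.2 hM, fun x ↦ ?_⟩
  · refine LipschitzWith.of_dist_le_mul fun x y ↦ ?_
    rw [Real.coe_toNNReal _ (by positivity), Real.dist_eq, dist_eq_norm]
    by_cases hx : x = 0
    · have h0 : radialGauge R x = 0 := by simp [hx, radialGauge]
      rw [h0, hx, zero_sub, zero_sub, abs_neg, norm_neg]
      exact (hub y).trans (by gcongr)
    by_cases hy : y = 0
    · have h0 : radialGauge R y = 0 := by simp [hy, radialGauge]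
      rw [h0, hy, sub_zero, sub_zero]
      exact (hub x).trans (by gcongr)
    exact hmain hx hy
  · by_cases hx : x = 0
    · simp [hx, radialGauge]
    · rw [radialGauge, homExt_of_ne hx, div_eq_inv_mul]
      gcongr
      · exact hpos _
      · exact (hb _).2

theorem IsLipschitzStarlike.eq_sublevel {Ω : Set (EuclideanSpace ℝ (Fin d))}
    (hΩ : IsLipschitzStarlike Ω R) (hd : 0 < d) : Ω = {x | radialGauge R x < 1} := by
  -- The origin belongs to Ω only because some direction ξ exists.
  have hne : Nonempty (USphere d) := by
    have : Nontrivial (EuclideanSpace ℝ (Fin d)) := by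
      rw [← Module.finrank_pos_iff (R := ℝ), finrank_euclideanSpace_fin]; exact hd
    exact (NormedSpace.sphere_nonempty.2 zero_le_one).to_subtype
  rw [hΩ.eq_set]
  ext x
  constructor
  · rintro ⟨ξ, r, hr0, hr, rfl⟩
    show radialGauge R (r • (ξ : EuclideanSpace ℝ (Fin d))) < 1
    rcases hr0.eq_or_lt with rfl | hr0
    · simp [radialGauge]
    · rw [radialGauge_smul hr0, radialGauge_coe, ← div_eq_mul_inv, div_lt_one (hΩ.pos ξ)]
      exact hr
  · intro hx
    by_cases hx0 : x = 0
    · obtain ⟨ξ⟩ := hne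
      exact ⟨ξ, 0, le_rfl, hΩ.pos ξ, by simp [hx0]⟩
    · have hx' : radialGauge R x < 1 := hx
      rw [radialGauge, homExt_of_ne hx0, div_lt_one (hΩ.pos _)] at hx'
      refine ⟨direction hx0, ‖x‖, norm_nonneg _, hx', ?_⟩
      simp [direction, smul_smul, hx0]

theorem IsGauge.frontier_sublevel {V : Type*} [NormedAddCommGroup V] [InnerProductSpace ℝ V]
    {g : V → ℝ} {c : ℝ} {L : ℝ≥0} (hg : IsGauge g c L) :
    frontier {x | g x < 1} = {x | g x = 1} := by
  refine (frontier_lt_subset_eq hg.continuous continuous_const).antisymm fun x hx ↦ ?_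
  have hx1 : g x = 1 := hx
  refine ⟨?_, fun h ↦ ?_⟩
  · have hlim : Tendsto (fun t : ℝ ↦ t • x) (𝓝[<] 1) (𝓝 x) := by
      have : Tendsto (fun t : ℝ ↦ t • x) (𝓝 1) (𝓝 ((1 : ℝ) • x)) :=
        (continuous_id.smul continuous_const).tendsto 1
      rw [one_smul] at this
      exact this.mono_left nhdsWithin_le_nhds
    refine mem_closure_of_tendsto hlim ?_
    filter_upwards [Ioo_mem_nhdsLT (zero_lt_one' ℝ)] with t ht
    show g (t • x) < 1
    rw [hg.map_smul t ht.1, hx1, mul_one]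
    exact ht.2
  · have : x ∈ {y | g y < 1} := interior_subset h
    exact (show g x < 1 from this).ne hx1

/-! ### The gradient of the gauge -/

theorem radialGauge_mul_homExt (hpos : ∀ ξ, 0 < R ξ) (x : EuclideanSpace ℝ (Fin d)) :
    radialGauge R x * homExt R x = ‖x‖ := by
  by_cases hx : x = 0
  · simp [hx, radialGauge]
  · rw [radialGauge, div_mul_cancel₀]
    rw [homExt_of_ne hx]
    exact (hpos _).ne'

theorem norm_gradient (f : EuclideanSpace ℝ (Fin d) → ℝ) (x : EuclideanSpace ℝ (Fin d)) :
    ‖gradient f x‖ = ‖fderiv ℝ f x‖ := by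
  rw [gradient, LinearIsometryEquiv.norm_map]

/-- The gradient of the norm has length 1 and inner product 1 with ξ: equality in Cauchy–Schwarz. -/
theorem toDual_symm_fderiv_norm (ξ : USphere d) :
    (InnerProductSpace.toDual ℝ (EuclideanSpace ℝ (Fin d))).symm
      (fderiv ℝ (‖·‖) (ξ : EuclideanSpace ℝ (Fin d))) = ξ := by
  have : Nontrivial (EuclideanSpace ℝ (Fin d)) := ⟨ξ, 0, coe_ne_zero ξ⟩
  have hd : DifferentiableAt ℝ (‖·‖) (ξ : EuclideanSpace ℝ (Fin d)) :=
    differentiableAt_id.norm ℝ (coe_ne_zero ξ)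
  refine (inner_eq_one_iff_of_norm_eq_one (𝕜 := ℝ) ?_ (norm_eq_of_mem_sphere ξ)).1 ?_
  · rw [LinearIsometryEquiv.norm_map, norm_fderiv_norm hd]
  · rw [InnerProductSpace.toDual_symm_apply, hd.fderiv_norm_self, norm_eq_of_mem_sphere]

theorem fderiv_homExt_apply_self {ξ : USphere d}
    (hR : DifferentiableAt ℝ (homExt R) (ξ : EuclideanSpace ℝ (Fin d))) :
    fderiv ℝ (homExt R) (ξ : EuclideanSpace ℝ (Fin d)) ξ = 0 := by
  set x := (ξ : EuclideanSpace ℝ (Fin d))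
  have h1 : HasDerivAt (fun t : ℝ ↦ homExt R (t • x)) (fderiv ℝ (homExt R) x x) 1 := by
    have h2 : HasDerivAt (fun t : ℝ ↦ t • x) x 1 := by
      simpa using (hasDerivAt_id (1 : ℝ)).smul_const x
    have h3 : HasFDerivAt (homExt R) (fderiv ℝ (homExt R) x) ((1 : ℝ) • x) := by
      simpa using hR.hasFDerivAt
    exact h3.comp_hasDerivAt _ h2
  have h2 : HasDerivAt (fun t : ℝ ↦ homExt R (t • x)) 0 1 := by
    refine (hasDerivAt_const (1 : ℝ) (homExt R x)).congr_of_eventuallyEq ?_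
    filter_upwards [lt_mem_nhds (zero_lt_one' ℝ)] with t ht
    exact homExt_smul ht x
  exact h1.unique h2

/-- The product rule for g·R = ‖x‖ gives ∇g = ξ/R − ∇R/R². The two terms are orthogonal because R is
constant along rays, so Pythagoras applies. -/
theorem norm_sq_fderiv_radialGauge (hpos : ∀ ξ, 0 < R ξ) {ξ : USphere d}
    (hR : DifferentiableAt ℝ (homExt R) (ξ : EuclideanSpace ℝ (Fin d))) :
    ‖fderiv ℝ (radialGauge R) (ξ : EuclideanSpace ℝ (Fin d))‖ ^ 2 =
      (R ξ)⁻¹ ^ 2 + ‖gradient (homExt R) (ξ : EuclideanSpace ℝ (Fin d))‖ ^ 2 * (R ξ)⁻¹ ^ 4 := by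
  set x := (ξ : EuclideanSpace ℝ (Fin d))
  have hRx : homExt R x = R ξ := homExt_coe ξ
  have hR0 := hpos ξ
  have hn : DifferentiableAt ℝ (‖·‖) x := differentiableAt_id.norm ℝ (coe_ne_zero ξ)
  have hg : DifferentiableAt ℝ (radialGauge R) x := by
    have : radialGauge R = fun y ↦ ‖y‖ * (homExt R y)⁻¹ := by
      ext y; rw [radialGauge, div_eq_mul_inv]
    rw [this]
    exact hn.mul (hR.inv (by rw [hRx]; exact hR0.ne'))
  have hprod : (fun y ↦ radialGauge R y * homExt R y) = (‖·‖) := by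
    ext y; exact radialGauge_mul_homExt hpos y
  have h1 : radialGauge R x • fderiv ℝ (homExt R) x + homExt R x • fderiv ℝ (radialGauge R) x =
      fderiv ℝ (‖·‖) x := by
    rw [← hprod]
    exact (fderiv_fun_mul hg hR).symm
  have h2 := congrArg (InnerProductSpace.toDual ℝ (EuclideanSpace ℝ (Fin d))).symm h1
  rw [map_add, map_smul, map_smul, toDual_symm_fderiv_norm, hRx, radialGauge_coe] at h2
  change (R ξ)⁻¹ • gradient (homExt R) x + R ξ • gradient (radialGauge R) x = x at h2
  have h3 : gradient (radialGauge R) x = (R ξ)⁻¹ • x - ((R ξ)⁻¹ ^ 2) • gradient (homExt R) x := by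
    have := congrArg ((R ξ)⁻¹ • ·) h2
    simp only [smul_add, smul_smul, inv_mul_cancel₀ hR0.ne', one_smul] at this
    rw [← this]
    module
  have h4 : ⟪x, gradient (homExt R) x⟫ = 0 := by
    rw [real_inner_comm, gradient, InnerProductSpace.toDual_symm_apply]
    exact fderiv_homExt_apply_self hR
  rw [← norm_gradient, h3, norm_sub_sq_real, real_inner_smul_left, real_inner_smul_right, h4,
    norm_smul, norm_smul, norm_eq_of_mem_sphere ξ, Real.norm_of_nonneg (inv_nonneg.2 hR0.le),
    Real.norm_of_nonneg (by positivity : 0 ≤ (R ξ)⁻¹ ^ 2)]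
  ring

/-- Where R is not differentiable, neither is g, and the left side takes the default value 0. Being
valid at every ξ, the inequality makes it unnecessary to know that R is differentiable almost
everywhere on the sphere. -/
theorem norm_sq_fderiv_radialGauge_le (hpos : ∀ ξ, 0 < R ξ) (ξ : USphere d) :
    ‖fderiv ℝ (radialGauge R) (ξ : EuclideanSpace ℝ (Fin d))‖ ^ 2 ≤
      (R ξ)⁻¹ ^ 2 + ‖gradient (homExt R) (ξ : EuclideanSpace ℝ (Fin d))‖ ^ 2 * (R ξ)⁻¹ ^ 4 := by
  by_cases hR : DifferentiableAt ℝ (homExt R) (ξ : EuclideanSpace ℝ (Fin d))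
  · exact (norm_sq_fderiv_radialGauge hpos hR).le
  · have hg : ¬ DifferentiableAt ℝ (radialGauge R) (ξ : EuclideanSpace ℝ (Fin d)) := by
      intro hg
      refine hR ?_
      have hn : DifferentiableAt ℝ (‖·‖) (ξ : EuclideanSpace ℝ (Fin d)) :=
        differentiableAt_id.norm ℝ (coe_ne_zero ξ)
      have h0 : radialGauge R ξ ≠ 0 := by
        rw [radialGauge_coe]; exact inv_ne_zero (hpos ξ).ne'
      refine (hn.mul (hg.inv h0)).congr_of_eventuallyEq ?_
      filter_upwards [isOpen_ne.mem_nhds (coe_ne_zero ξ)] with y hy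
      have hy1 := radialGauge_mul_homExt hpos y
      have hy2 : radialGauge R y ≠ 0 := by
        intro h
        rw [h, zero_mul] at hy1
        exact hy (norm_eq_zero.1 hy1.symm)
      simp only [Pi.mul_apply, Pi.inv_apply, ← hy1]
      field_simp
    rw [fderiv_zero_of_not_differentiableAt hg]
    have := hpos ξ
    rw [norm_zero, zero_pow two_ne_zero]
    positivity

theorem norm_sq_gradient_homExt_le (hpos : ∀ ξ, 0 < R ξ) {c : ℝ} {L : ℝ≥0}
    (hg : IsGauge (radialGauge R) c L) (ξ : USphere d) :
    ‖gradient (homExt R) (ξ : EuclideanSpace ℝ (Fin d))‖ ^ 2 ≤ L ^ 2 * R ξ ^ 4 := by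
  have hR0 := hpos ξ
  by_cases hR : DifferentiableAt ℝ (homExt R) (ξ : EuclideanSpace ℝ (Fin d))
  · have h1 := norm_sq_fderiv_radialGauge hpos hR
    have h2 : ‖fderiv ℝ (radialGauge R) (ξ : EuclideanSpace ℝ (Fin d))‖ ^ 2 ≤ L ^ 2 := by
      gcongr; exact hg.norm_fderiv_le _
    set G := ‖gradient (homExt R) (ξ : EuclideanSpace ℝ (Fin d))‖ ^ 2
    calc G = (G * (R ξ)⁻¹ ^ 4) * R ξ ^ 4 := by field_simp
      _ ≤ _ := by
        gcongr
        have : 0 ≤ (R ξ)⁻¹ ^ 2 := by positivity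
        linarith
  · rw [gradient_eq_zero_of_not_differentiableAt hR, norm_zero, zero_pow two_ne_zero]
    positivity

end Gauge

end

section

/-! ### Polar coordinates and comparison of the geometric factors -/

variable {d : ℕ} {R : USphere d → ℝ}

/-- Integration of a function that is homogeneous of degree `0` over a starlike domain. -/
theorem lintegral_sublevel_radialGauge (hd : 0 < d) (hpos : ∀ ξ, 0 < R ξ) {c : ℝ} {L : ℝ≥0}
    (hg : IsGauge (radialGauge R) c L) {φ : EuclideanSpace ℝ (Fin d) → ℝ≥0∞} (hφ : Measurable φ)
    (hφs : ∀ t : ℝ, 0 < t → ∀ x, φ (t • x) = φ x) :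
    d * ∫⁻ x in {x | radialGauge R x < 1}, φ x =
      ∫⁻ ξ, ENNReal.ofReal (R ξ ^ d) * φ ξ ∂(sphereMeasure d) := by
  have hnt : Nontrivial (EuclideanSpace ℝ (Fin d)) := by
    rw [← Module.finrank_pos_iff (R := ℝ), finrank_euclideanSpace_fin]; exact hd
  have hS : MeasurableSet {x | radialGauge R x < 1} := (hg.isOpen_sublevel 1).measurableSet
  set F : EuclideanSpace ℝ (Fin d) → ℝ≥0∞ := {x | radialGauge R x < 1}.indicator φ
  have hF : Measurable F := hφ.indicator hS
  set G : USphere d × Ioi (0 : ℝ) → ℝ≥0∞ := fun p ↦ F (p.2.1 • (p.1 : EuclideanSpace ℝ (Fin d)))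
  have hG : Measurable G := hF.comp (by fun_prop)
  have h1 : ∫⁻ x in {x | radialGauge R x < 1}, φ x =
      ∫⁻ p, G p ∂((sphereMeasure d).prod (volumeIoiPow (d - 1))) := by
    have hmp :=
      (volume : Measure (EuclideanSpace ℝ (Fin d))).measurePreserving_homeomorphUnitSphereProd
    rw [finrank_euclideanSpace_fin] at hmp
    rw [← lintegral_indicator hS, ← hmp.lintegral_comp hG]
    have h2 : ∀ x : ({0}ᶜ : Set (EuclideanSpace ℝ (Fin d))),
        G (homeomorphUnitSphereProd _ x) = F x := by
      intro x
      have hx : ‖(x : EuclideanSpace ℝ (Fin d))‖ ≠ 0 := norm_ne_zero_iff.2 x.2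
      simp [G, smul_smul, hx]
    simp only [h2]
    rw [lintegral_subtype_comap (measurableSet_singleton _).compl, restrict_compl_singleton]
  rw [h1, lintegral_prod _ hG.aemeasurable,
    ← lintegral_const_mul _ hG.lintegral_prod_right']
  refine lintegral_congr fun ξ ↦ ?_
  -- Along the ray through ξ the integrand is the constant `φ ξ` for r < R ξ and 0 beyond; the
  -- radial weight r^(d-1) contributes R^d/d.
  have h3 : ∀ r : Ioi (0 : ℝ), G (ξ, r) =
      (Iio (⟨R ξ, hpos ξ⟩ : Ioi (0 : ℝ))).indicator (fun _ ↦ φ ξ) r := by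
    intro r
    have hr : 0 < r.1 := r.2
    have hmem : r.1 • (ξ : EuclideanSpace ℝ (Fin d)) ∈ {x | radialGauge R x < 1} ↔
        r ∈ Iio (⟨R ξ, hpos ξ⟩ : Ioi (0 : ℝ)) := by
      show radialGauge R (r.1 • (ξ : EuclideanSpace ℝ (Fin d))) < 1 ↔ r.1 < R ξ
      rw [radialGauge_smul hr, radialGauge_coe, ← div_eq_mul_inv, div_lt_one (hpos ξ)]
    by_cases h : r ∈ Iio (⟨R ξ, hpos ξ⟩ : Ioi (0 : ℝ))
    · rw [indicator_of_mem h]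
      simp only [G, F]
      rw [indicator_of_mem (hmem.2 h), hφs _ hr]
    · rw [indicator_of_notMem h]
      simp only [G, F]
      rw [indicator_of_notMem (mt hmem.1 h)]
  simp only [h3]
  rw [lintegral_indicator measurableSet_Iio, setLIntegral_const, volumeIoiPow_apply_Iio,
    Nat.sub_add_cancel hd, Nat.cast_pred hd, sub_add_cancel, mul_left_comm, mul_comm,
    ← ENNReal.ofReal_natCast, ← ENNReal.ofReal_mul (by positivity)]
  congr 2
  have : (d : ℝ) ≠ 0 := by exact_mod_cast hd.ne'
  field_simp

theorem isGauge_norm {V : Type*} [NormedAddCommGroup V] [InnerProductSpace ℝ V] :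
    IsGauge (fun x : V ↦ ‖x‖) 1 1 :=
  ⟨lipschitzWith_one_norm, fun t ht x ↦ by rw [norm_smul, Real.norm_of_nonneg ht.le],
    one_pos, fun x ↦ (one_mul _).le⟩

/-- The norm is itself a gauge, with gradient of length 1 almost everywhere. -/
theorem boundaryArea_ball (hd : 0 < d) :
    boundaryArea (ball (0 : EuclideanSpace ℝ (Fin d)) 1) =
      d * volume.real (ball (0 : EuclideanSpace ℝ (Fin d)) 1) := by
  have hnt : Nontrivial (EuclideanSpace ℝ (Fin d)) := by
    rw [← Module.finrank_pos_iff (R := ℝ), finrank_euclideanSpace_fin]; exact hd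
  have hball : {x : EuclideanSpace ℝ (Fin d) | ‖x‖ < 1} = ball 0 1 := by ext; simp
  have h := (isGauge_norm (V := EuclideanSpace ℝ (Fin d))).area_level_set
  have hI : ∫⁻ z in {z : EuclideanSpace ℝ (Fin d) | ‖z‖ < 1}, ‖fderiv ℝ (fun x ↦ ‖x‖) z‖ₑ =
      volume (ball (0 : EuclideanSpace ℝ (Fin d)) 1) := by
    rw [hball, ← setLIntegral_one]
    refine lintegral_congr_ae (ae_restrict_of_ae ?_)
    filter_upwards [ae_differentiableAt_norm] with x hx
    rw [← ofReal_norm, norm_fderiv_norm hx, ENNReal.ofReal_one]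
  have hf : frontier (ball (0 : EuclideanSpace ℝ (Fin d)) 1) = {x | ‖x‖ = 1} := by
    rw [← hball]; exact isGauge_norm.frontier_sublevel
  rw [hI, finrank_euclideanSpace_fin] at h
  rw [boundaryArea, measureReal_def, hf, h, ENNReal.toReal_mul, ENNReal.toReal_natCast]
  rfl

theorem sq_lintegral_le {α : Type*} [MeasurableSpace α] (μ : Measure α) {f : α → ℝ≥0∞}
    (hf : AEMeasurable f μ) : (∫⁻ x, f x ∂μ) ^ 2 ≤ μ univ * ∫⁻ x, f x ^ 2 ∂μ := by
  have h := ENNReal.lintegral_mul_le_Lp_mul_Lq μ Real.HolderConjugate.two_two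
    (f := fun _ ↦ 1) (g := f) aemeasurable_const hf
  simp only [Pi.mul_apply, one_mul, ENNReal.rpow_ofNat, one_pow, lintegral_one] at h
  calc _ ≤ (μ univ ^ (1 / 2 : ℝ) * (∫⁻ x, f x ^ 2 ∂μ) ^ (1 / 2 : ℝ)) ^ 2 := by gcongr
    _ = _ := by
      rw [mul_pow, ← ENNReal.rpow_natCast, ← ENNReal.rpow_natCast, ← ENNReal.rpow_mul,
        ← ENNReal.rpow_mul]
      norm_num

/-- The integrand in the numerator of `G0`. -/
noncomputable def energyDensity (R : USphere d → ℝ) (ξ : USphere d) : ℝ :=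
  R ξ ^ ((d : ℤ) - 2) +
    ‖gradient (homExt R) (ξ : EuclideanSpace ℝ (Fin d))‖ ^ 2 * R ξ ^ ((d : ℤ) - 4)

theorem energyDensity_eq (hpos : ∀ ξ, 0 < R ξ) (ξ : USphere d) :
    energyDensity R ξ = R ξ ^ d * ((R ξ)⁻¹ ^ 2 +
      ‖gradient (homExt R) (ξ : EuclideanSpace ℝ (Fin d))‖ ^ 2 * (R ξ)⁻¹ ^ 4) := by
  have h := (hpos ξ).ne'
  rw [energyDensity, zpow_sub₀ h, zpow_sub₀ h, zpow_natCast, zpow_ofNat, zpow_ofNat]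
  field_simp

theorem integrable_energyDensity (hpos : ∀ ξ, 0 < R ξ) (hR : Continuous R) {c : ℝ} {L : ℝ≥0}
    (hg : IsGauge (radialGauge R) c L) : Integrable (energyDensity R) (sphereMeasure d) := by
  obtain ⟨m, M, hm, hM, hb⟩ := exists_bounds hpos hR
  have hmeas : Measurable (energyDensity R) := by
    have h1 : energyDensity R = fun ξ ↦ R ξ ^ d * ((R ξ)⁻¹ ^ 2 +
        ‖fderiv ℝ (homExt R) (ξ : EuclideanSpace ℝ (Fin d))‖ ^ 2 * (R ξ)⁻¹ ^ 4) := by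
      ext ξ; rw [energyDensity_eq hpos, norm_gradient]
    have h2 : Measurable fun ξ : USphere d ↦
        fderiv ℝ (homExt R) (ξ : EuclideanSpace ℝ (Fin d)) :=
      (measurable_fderiv ℝ (homExt R)).comp measurable_subtype_coe
    have h3 := hR.measurable
    rw [h1]
    fun_prop
  refine Integrable.of_bound hmeas.aestronglyMeasurable (M ^ d * (m⁻¹ ^ 2 + L ^ 2))
    (Eventually.of_forall fun ξ ↦ ?_)
  have h0 := hpos ξ
  rw [energyDensity_eq hpos, Real.norm_of_nonneg (by positivity)]
  have h4 : ‖gradient (homExt R) (ξ : EuclideanSpace ℝ (Fin d))‖ ^ 2 * (R ξ)⁻¹ ^ 4 ≤ L ^ 2 := by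
    calc _ ≤ (L ^ 2 * R ξ ^ 4) * (R ξ)⁻¹ ^ 4 := by
          gcongr; exact norm_sq_gradient_homExt_le hpos hg ξ
      _ = _ := by field_simp
  have h5 := (hb ξ).1
  have h6 := (hb ξ).2
  gcongr

theorem integral_pow_eq (hd : 0 < d) (hpos : ∀ ξ, 0 < R ξ) (hR : Continuous R) {c : ℝ} {L : ℝ≥0}
    (hg : IsGauge (radialGauge R) c L) :
    ∫ ξ, R ξ ^ d ∂(sphereMeasure d) = d * volume.real {x | radialGauge R x < 1} := by
  have h := lintegral_sublevel_radialGauge hd hpos hg (φ := fun _ ↦ 1) measurable_const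
    (fun _ _ _ ↦ rfl)
  simp only [setLIntegral_one, mul_one] at h
  rw [integral_eq_lintegral_of_nonneg_ae (Eventually.of_forall fun ξ ↦ (pow_pos (hpos ξ) d).le)
    (hR.pow d).aestronglyMeasurable, ← h, ENNReal.toReal_mul, ENNReal.toReal_natCast]
  rfl

/-- Cauchy–Schwarz for |∇g| against 1 on Ω, then polar coordinates for |∇g|², which is homogeneous
of degree 0. -/
theorem sq_gradient_integral_le (hd : 0 < d) (hpos : ∀ ξ, 0 < R ξ) (hR : Continuous R) {c : ℝ}
    {L : ℝ≥0} (hg : IsGauge (radialGauge R) c L) :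
    d * (∫⁻ z in {z | radialGauge R z < 1}, ‖fderiv ℝ (radialGauge R) z‖ₑ).toReal ^ 2 ≤
      volume.real {x | radialGauge R x < 1} * ∫ ξ, energyDensity R ξ ∂(sphereMeasure d) := by
  have hintegral := integrable_energyDensity hpos hR hg
  have hnn : ∀ ξ, 0 ≤ energyDensity R ξ := fun ξ ↦ by
    have := hpos ξ
    rw [energyDensity_eq hpos]; positivity
  have h := lintegral_sublevel_radialGauge hd hpos hg
    (φ := fun x ↦ ‖fderiv ℝ (radialGauge R) x‖ₑ ^ 2)
    ((measurable_fderiv ℝ _).enorm.pow_const 2)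
    (fun t ht x ↦ by rw [hg.fderiv_smul ht])
  have h2 : ∫⁻ ξ, ENNReal.ofReal (R ξ ^ d) *
      ‖fderiv ℝ (radialGauge R) (ξ : EuclideanSpace ℝ (Fin d))‖ₑ ^ 2 ∂(sphereMeasure d) ≤
      ENNReal.ofReal (∫ ξ, energyDensity R ξ ∂(sphereMeasure d)) := by
    rw [ofReal_integral_eq_lintegral_ofReal hintegral (Eventually.of_forall hnn)]
    refine lintegral_mono fun ξ ↦ ?_
    have h0 := hpos ξ
    rw [← ofReal_norm, ← ENNReal.ofReal_pow (norm_nonneg _),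
      ← ENNReal.ofReal_mul (by positivity), energyDensity_eq hpos]
    gcongr
    exact norm_sq_fderiv_radialGauge_le hpos ξ
  have h3 := sq_lintegral_le (volume.restrict {z | radialGauge R z < 1})
    (f := fun z ↦ ‖fderiv ℝ (radialGauge R) z‖ₑ) (measurable_fderiv ℝ _).enorm.aemeasurable
  rw [restrict_apply_univ] at h3
  have h4 : (d : ℝ≥0∞) * (∫⁻ z in {z | radialGauge R z < 1},
      ‖fderiv ℝ (radialGauge R) z‖ₑ) ^ 2 ≤ volume {z | radialGauge R z < 1} *
        ENNReal.ofReal (∫ ξ, energyDensity R ξ ∂(sphereMeasure d)) := by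
    calc _ ≤ (d : ℝ≥0∞) * (volume {z | radialGauge R z < 1} *
          ∫⁻ z in {z | radialGauge R z < 1}, ‖fderiv ℝ (radialGauge R) z‖ₑ ^ 2) := by gcongr
      _ = volume {z | radialGauge R z < 1} * (d *
          ∫⁻ z in {z | radialGauge R z < 1}, ‖fderiv ℝ (radialGauge R) z‖ₑ ^ 2) := by ring
      _ ≤ _ := by rw [h]; gcongr
  have h5 := ENNReal.toReal_mono
    (ENNReal.mul_ne_top (hg.volume_sublevel_lt_top 1).ne ENNReal.ofReal_ne_top) h4
  rw [ENNReal.toReal_mul, ENNReal.toReal_mul, ENNReal.toReal_pow, ENNReal.toReal_natCast,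
    ENNReal.toReal_ofReal (integral_nonneg hnn)] at h5
  exact h5

theorem rpow_div_of_pow {α : ℝ} (hα : 0 ≤ α) (hd : 0 < d) (k : ℝ) :
    (α ^ d) ^ (k / (d : ℝ)) = α ^ k := by
  have : (d : ℝ) ≠ 0 := by exact_mod_cast hd.ne'
  rw [← Real.rpow_natCast, ← Real.rpow_mul hα]
  congr 1
  field_simp

theorem isoRatio_eq {Ω : Set (EuclideanSpace ℝ (Fin d))} (hd : 0 < d) {α : ℝ} (hα : 0 ≤ α)
    (hvol : volume.real Ω = α ^ d) : isoRatio Ω = boundaryArea Ω / α ^ (d - 1) := by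
  rw [isoRatio, hvol, rpow_div_of_pow hα hd, ← Nat.cast_pred hd, Real.rpow_natCast]

theorem G0_eq (hd : 2 ≤ d) {α β : ℝ} (hα : 0 < α) (hβ : 0 < β)
    (hpow : ∫ ξ, R ξ ^ d ∂(sphereMeasure d) = d * α ^ d)
    (hball : volume.real (ball (0 : EuclideanSpace ℝ (Fin d)) 1) = β ^ d) :
    G0 R = (∫ ξ, energyDensity R ξ ∂(sphereMeasure d)) / (d * β ^ 2 * α ^ (d - 2)) := by
  have hd0 : (d : ℝ) ≠ 0 := by positivity
  have hS : (sphereMeasure d).real univ = d * β ^ d := by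
    rw [toSphere_real_apply_univ, finrank_euclideanSpace_fin, hball]
  have h1 : (d * β ^ d)⁻¹ * (d * α ^ d) = (α / β) ^ d := by
    rw [div_pow]; field_simp
  have h2 : β ^ d = β ^ 2 * β ^ (d - 2) := by rw [← pow_add]; congr 1; omega
  have h3 : ((d : ℝ) - 2) = ((d - 2 : ℕ) : ℝ) := by push_cast [hd]; rfl
  rw [G0, average_eq, average_eq, hS, hpow, smul_eq_mul, smul_eq_mul, h1,
    rpow_div_of_pow (by positivity) (by omega), h3, Real.rpow_natCast, div_pow, h2]
  change _ * (∫ ξ, energyDensity R ξ ∂(sphereMeasure d)) / _ = _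
  field_simp

theorem IsLipschitzStarlike.GRobin_le_G0_and_one_le_GRobin (hd : 2 ≤ d)
    {Ω : Set (EuclideanSpace ℝ (Fin d))} (hΩ : IsLipschitzStarlike Ω R) :
    GRobin Ω ≤ G0 R ∧ 1 ≤ GRobin Ω := by
  have hd0 : 0 < d := by omega
  have hdR : (0 : ℝ) < d := by exact_mod_cast hd0
  have hnt : Nontrivial (EuclideanSpace ℝ (Fin d)) := by
    rw [← Module.finrank_pos_iff (R := ℝ), finrank_euclideanSpace_fin]; exact hd0
  have hpos := hΩ.pos
  obtain ⟨K, hK⟩ := hΩ.lipschitz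
  obtain ⟨c, L, hg⟩ := isGauge_radialGauge hpos hK
  -- Writing the volumes as d-th powers turns the real exponents (d−1)/d and (d−2)/d into natural
  -- powers.
  have hroot : ∀ S : Set (EuclideanSpace ℝ (Fin d)), 0 < volume S → volume S < ∞ →
      ∃ α : ℝ, 0 < α ∧ volume.real S = α ^ d ∧ volume S = ENNReal.ofReal (α ^ d) := by
    intro S h0 h1
    have h2 : 0 < volume.real S := ENNReal.toReal_pos h0.ne' h1.ne
    have h3 : (volume.real S ^ (d : ℝ)⁻¹) ^ d = volume.real S :=
      Real.rpow_inv_natCast_pow h2.le hd0.ne'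
    refine ⟨volume.real S ^ (d : ℝ)⁻¹, Real.rpow_pos_of_pos h2 _, h3.symm, ?_⟩
    rw [h3, measureReal_def, ENNReal.ofReal_toReal h1.ne]
  obtain ⟨α, hα, hαr, hαe⟩ := hroot {x | radialGauge R x < 1}
    (hg.volume_sublevel_pos one_pos) (hg.volume_sublevel_lt_top 1)
  obtain ⟨β, hβ, hβr, hβe⟩ := hroot (ball (0 : EuclideanSpace ℝ (Fin d)) 1)
    (measure_ball_pos _ _ one_pos) measure_ball_lt_top
  have hset := hΩ.eq_sublevel hd0
  set I := (∫⁻ z in {z | radialGauge R z < 1}, ‖fderiv ℝ (radialGauge R) z‖ₑ).toReal with hI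
  have harea : boundaryArea Ω = d * I := by
    have h := hg.area_level_set
    rw [finrank_euclideanSpace_fin] at h
    rw [boundaryArea, measureReal_def, hset, hg.frontier_sublevel, h, ENNReal.toReal_mul,
      ENNReal.toReal_natCast]
  have hRob : GRobin Ω = (I / (α ^ (d - 1) * β)) ^ 2 := by
    rw [GRobin, isoRatio_eq hd0 hα.le (by rw [hset, hαr]), isoRatio_eq hd0 hβ.le hβr, harea,
      boundaryArea_ball hd0, hβr]
    congr 1
    have : β ^ d = β * β ^ (d - 1) := by rw [← pow_succ', Nat.sub_add_cancel hd0]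
    rw [this]
    field_simp
  have hiso : α ^ (d - 1) * β ≤ I :=
    (ENNReal.ofReal_le_iff_le_toReal hg.lintegral_enorm_fderiv_lt_top.ne).1
      (hg.isoperimetric hα hβ hd0 hαe hβe)
  have hCS := sq_gradient_integral_le hd0 hpos hK.continuous hg
  rw [← hI, hαr] at hCS
  have hG0 := G0_eq hd hα hβ ((integral_pow_eq hd0 hpos hK.continuous hg).trans (by rw [hαr])) hβr
  refine ⟨?_, ?_⟩
  · rw [hRob, hG0, div_pow, div_le_div_iff₀ (by positivity) (by positivity)]
    -- The truncated subtraction d − 2 is exact here because d ≥ 2.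
    have e1 : α ^ (d - 1) * α ^ (d - 1) = α ^ d * α ^ (d - 2) := by
      rw [← pow_add, ← pow_add]; congr 1; omega
    calc _ = (d * I ^ 2) * (β ^ 2 * α ^ (d - 2)) := by ring
      _ ≤ (α ^ d * ∫ ξ, energyDensity R ξ ∂(sphereMeasure d)) * (β ^ 2 * α ^ (d - 2)) := by gcongr
      _ = (∫ ξ, energyDensity R ξ ∂(sphereMeasure d)) * (α ^ d * α ^ (d - 2) * β ^ 2) := by ring
      _ = _ := by rw [← e1]; ring
  · rw [hRob]
    exact one_le_pow₀ ((one_le_div (by positivity)).2 hiso)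

end

end Starlike

end

theorem lemma3p4 (d : ℕ) (hd : 2 ≤ d) (Ω : Set (EuclideanSpace ℝ (Fin d)))
    (R : Starlike.USphere d → ℝ) (hΩ : Starlike.IsLipschitzStarlike Ω R) :
    Starlike.G0 R ≥ Starlike.GRobin Ω ∧ Starlike.GRobin Ω ≥ 1 :=
  hΩ.GRobin_le_G0_and_one_le_GRobin hd
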